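/- Let $\mathbb{T}=\mathbb{R}/\mathbb{Z}$ with its Haar probability measure and let $[0,1]$ carry Lebesgue measure. For $X\in\{\mathbb{T},[0,1]\}$ and a nonnegative integer $N$, equip $X^N$ with the product measure $dx$, write $[N]=\{1,\dots,N\}$, and let $\|\cdot\|_1,\|\cdot\|_2$ be the norms of $L_1(X^N)$ and $L_2(X^N)$. For a real-valued function $f\in\mathcal{C}^1(X^N)$ (for $X=[0,1]$: continuously differentiable up to the boundary), with partial derivatives $\partial_1 f,\dots,\partial_N f$, put $$\|\vec\partial f\|_{L_1\ell_1^N}:=\int_{X^N}\sum_{n=1}^N|\partial_n f(x)|\,dx .$$ For $S\subseteq[N]$, let $E_Sf$ be the function obtained from $f$ by integrating out, one after another, all coordinates $x_n$ with $n\in[N]\setminus S$. **Theorem 2.1.** (i) For every $\varepsilon>0$ there is an integer $q\ge 1$, depending only on $\varepsilon$, such that for every $N$ the following holds. If $f\in\mathcal{C}^1(\mathbb{T}^N)$ satisfies $\|\vec\partial f\|_{L_1\ell_1^N}\le 1$ and $\|f-\int f\|_2\le 1$, then there is a set $S\subseteq[N]$ with $|S|\le q$ such that $$\|f-E_Sf\|_1<\varepsilon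 .$$ (ii) The same holds with $[0,1]^N$ in place of $\mathbb{T}^N$, possibly with a different dependence of $q$ on $\varepsilon$. -/

import Mathlib

open MeasureTheory
open scoped ENNReal

namespace Junta

noncomputable section

/-- The product measure `μ^N` on `X^N`. -/
abbrev powMeasure {X : Type*} [MeasurableSpace X] (μ : Measure X) (N : ℕ) :
    Measure (Fin N → X) :=
  Measure.pi fun _ : Fin N => μ

/-- The operator `E_{[N] \ {n}}`, integrating out the `n`-th coordinate against `μ`. -/
def integrateOut {X : Type*} [MeasurableSpace X] (μ : Measure X) {N : ℕ} (n : Fin N)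
    (f : (Fin N → X) → ℝ) : (Fin N → X) → ℝ :=
  fun x => ∫ y, f (Function.update x n y) ∂μ

/-- The operator `E_S`: the composition of the operators `E_{[N] \ {n}}` over all `n ∉ S`,
so that `S` is the set of coordinates on which the dependence of `f` is retained. The order of
composition is immaterial for integrable `f`; here it is the increasing order of `n`. -/
def condE {X : Type*} [MeasurableSpace X] (μ : Measure X) {N : ℕ} (S : Finset (Fin N))
    (f : (Fin N → X) → ℝ) : (Fin N → X) → ℝ :=
  (Sᶜ.sort (· ≤ ·)).foldr (fun n g => integrateOut μ n g) f

/-- The norm `‖F‖_{L_p ℓ_p^N} = (∫ ‖F(x)‖_{ℓ_p^N}^p dν(x))^{1/p}` of a vector-valued function,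
as an element of `[0, ∞]`. -/
def mixedNorm {Ω : Type*} [MeasurableSpace Ω] (p : ℝ≥0∞) [Fact (1 ≤ p)] (ν : Measure Ω) {N : ℕ}
    (F : Ω → Fin N → ℝ) : ℝ≥0∞ :=
  eLpNorm (fun x => WithLp.toLp p (F x)) p ν

/-- The Haar probability measure on the circle `𝕋 = ℝ/ℤ`. -/
abbrev haarCircle : Measure UnitAddCircle := volume

/-- Lebesgue measure on `[0,1]`, as a measure on `ℝ`. -/
abbrev lebUnit : Measure ℝ := volume.restrict (Set.Icc 0 1)

/-- `f ∈ C¹(𝕋^N)`: the lift of `f` along the quotient map `ℝ^N → 𝕋^N` is `C¹`. -/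
def IsC1Torus {N : ℕ} (f : (Fin N → UnitAddCircle) → ℝ) : Prop :=
  ContDiff ℝ 1 fun x : Fin N → ℝ => f fun n => (x n : UnitAddCircle)

/-- The vector `(∂_n f(x))_n` of partial derivatives of a function on `𝕋^N`. -/
def gradTorus {N : ℕ} (f : (Fin N → UnitAddCircle) → ℝ) (x : Fin N → UnitAddCircle) :
    Fin N → ℝ :=
  fun n => deriv (fun t : ℝ => f (Function.update x n (x n + (t : UnitAddCircle)))) 0

/-- `f ∈ C¹([0,1]^N)`: continuously differentiable up to the boundary of the cube. A function on
the cube is represented by a function on `ℝ^N` of which only the values on the cube matter. -/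
def IsC1Cube {N : ℕ} (f : (Fin N → ℝ) → ℝ) : Prop :=
  ContDiffOn ℝ 1 f (Set.Icc 0 1)

/-- The vector `(∂_n f(x))_n` of partial derivatives of a function on `[0,1]^N`, one-sided at
the boundary of the cube. -/
def gradCube {N : ℕ} (f : (Fin N → ℝ) → ℝ) (x : Fin N → ℝ) : Fin N → ℝ :=
  fun n => derivWithin (fun t : ℝ => f (Function.update x n t)) (Set.Icc 0 1) (x n)

end

end Junta

/-!
The statement is a Friedgut-type junta theorem, and it is deduced from Friedgut's theorem for
bounded real functions on the Boolean cube (`exists_junta_boolean`): if `|h| ≤ M` and the sum of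
the influences `E|h(x) - h(x ⊕ e_i)|` is at most `K`, then dropping the Walsh characters that meet
a bit of influence below `δ` changes `h` in `L²` by at most `(M K / d + 3ᵈ K √(M δ))^(1/2)`, for
any `d ≥ 1`. The first term bounds the characters of degree at least `d`, the second one those of
smaller degree, by Bonami's inequality (`expect_sum_walsh_pow_four_le`).

For a `C¹` function on `[0, 1]^N`, the bits are the binary digits of the coordinates. Flipping the
digit of weight `2⁻ʲ` of `x_n` moves the point by `2⁻ʲ`, so that, up to a small discretization
error, the influence of this bit is at most a constant times `2⁻ʲ ‖∂_n f‖_1`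
(`bitInfluence_grid_le`, `gridVariation_le`). These bounds are summable in `j`, hence the total
influence of all the digits is bounded by a constant, no matter how many digits are used. One may
therefore restrict `f` to a dyadic grid so fine, depending on `f`, that the discretization error
is negligible, while the size of the junta depends on `ε` only. Boundedness is achieved by
truncating `f - ∫ f` at a height of order `1 / ε`, which is where the `L²` hypothesis is used
(`exists_junta_cube`).

Since `E_S` is an `L¹` contraction that fixes the functions of the coordinates in `S`, the
function `E_S f` is at most twice as far from `f` as any such function
(`integral_abs_sub_condE_le`); this gives the theorem on the cube. A function on the torus is
pulled back to the cube along the covering map, which preserves the measure, the gradient and the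
operators `E_S`.
-/

namespace Junta

/-! ### Fourier analysis on the Boolean cube and Friedgut's theorem -/

section BooleanCube

open Finset
open scoped BigOperators

variable {ι : Type*}

/-- The sign `±1` encoded by a bit. -/
def bitSign (b : Bool) : ℝ := if b then -1 else 1

/-- The Walsh character `χ_A` of the Boolean cube. -/
def walsh (A : Finset ι) (x : ι → Bool) : ℝ := ∏ i ∈ A, bitSign (x i)

lemma bitSign_not (b : Bool) : bitSign (!b) = -bitSign b := by cases b <;> simp [bitSign]

lemma bitSign_sq (b : Bool) : bitSign b ^ 2 = 1 := by cases b <;> simp [bitSign]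

lemma walsh_mul_self (A : Finset ι) (x : ι → Bool) : walsh A x * walsh A x = 1 := by
  rw [walsh, ← prod_mul_distrib]
  exact prod_eq_one fun i _ => by rw [← sq, bitSign_sq]

variable [DecidableEq ι]

/-- Negating the `i`-th bit. -/
def flipBit (i : ι) (x : ι → Bool) : ι → Bool := Function.update x i (!x i)

lemma flipBit_flipBit (i : ι) (x : ι → Bool) : flipBit i (flipBit i x) = x := by
  simp [flipBit]

lemma walsh_flipBit (A : Finset ι) (i : ι) (x : ι → Bool) :
    walsh A (flipBit i x) = if i ∈ A then -walsh A x else walsh A x := by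
  have key : ∀ B : Finset ι, i ∉ B → walsh B (flipBit i x) = walsh B x := by
    intro B hB
    refine prod_congr rfl fun j hj => ?_
    rw [flipBit, Function.update_of_ne (by rintro rfl; exact hB hj)]
  split_ifs with h
  · rw [← insert_erase h, walsh, walsh, prod_insert (notMem_erase i A),
      prod_insert (notMem_erase i A)]
    have := key _ (notMem_erase i A)
    rw [walsh, walsh] at this
    rw [this]
    simp [flipBit, bitSign_not]
  · exact key A h

variable [Fintype ι]

/-- The Walsh–Fourier coefficient `ĥ(A)`. -/
noncomputable def walshCoeff (h : (ι → Bool) → ℝ) (A : Finset ι) : ℝ := 𝔼 x, h x * walsh A x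

lemma expect_flipBit (i : ι) (F : (ι → Bool) → ℝ) : 𝔼 x, F (flipBit i x) = 𝔼 x, F x :=
  Fintype.expect_bijective (flipBit i)
    (Function.Involutive.bijective (flipBit_flipBit i)) _ _ fun _ => rfl

lemma expect_walsh_mul_walsh (A B : Finset ι) :
    𝔼 x, walsh A x * walsh B x = if A = B then 1 else 0 := by
  split_ifs with h
  · subst h
    simp [walsh_mul_self]
  · obtain ⟨i, hi⟩ : ∃ i, ¬ (i ∈ A ↔ i ∈ B) := by
      by_contra! hc
      exact h (Finset.ext hc)
    have h1 := expect_flipBit i (fun x => walsh A x * walsh B x)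
    have h2 : ∀ x, walsh A (flipBit i x) * walsh B (flipBit i x) = -(walsh A x * walsh B x) := by
      intro x
      rw [walsh_flipBit, walsh_flipBit]
      by_cases hA : i ∈ A <;> by_cases hB : i ∈ B <;> simp_all
    simp only [h2, expect_neg_distrib] at h1
    linarith

lemma expect_sum_walsh_mul_sum_walsh (s : Finset (Finset ι)) (c e : Finset ι → ℝ) :
    𝔼 x, (∑ A ∈ s, c A * walsh A x) * (∑ A ∈ s, e A * walsh A x) = ∑ A ∈ s, c A * e A := by
  have : ∀ x, (∑ A ∈ s, c A * walsh A x) * (∑ A ∈ s, e A * walsh A x)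
      = ∑ A ∈ s, ∑ B ∈ s, (c A * e B) * (walsh A x * walsh B x) := by
    intro x
    rw [sum_mul_sum]
    refine sum_congr rfl fun A _ => sum_congr rfl fun B _ => by ring
  simp only [this, expect_sum_comm, ← mul_expect, expect_walsh_mul_walsh]
  refine sum_congr rfl fun A hA => ?_
  simp [hA]

lemma expect_sum_walsh_sq (s : Finset (Finset ι)) (c : Finset ι → ℝ) :
    𝔼 x, (∑ A ∈ s, c A * walsh A x) ^ 2 = ∑ A ∈ s, c A ^ 2 := by
  simp only [sq, expect_sum_walsh_mul_sum_walsh]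

lemma sum_walsh_mul_walsh (x y : ι → Bool) :
    ∑ A, walsh A x * walsh A y = if x = y then (Fintype.card (ι → Bool) : ℝ) else 0 := by
  have h1 : ∑ A, walsh A x * walsh A y = ∏ i, (1 + bitSign (x i) * bitSign (y i)) := by
    rw [prod_one_add, powerset_univ]
    simp [walsh, prod_mul_distrib]
  rw [h1]
  split_ifs with h
  · subst h
    simp only [← sq, bitSign_sq]
    norm_num
  · obtain ⟨i, hi⟩ := Function.ne_iff.1 h
    refine prod_eq_zero (mem_univ i) ?_
    revert hi
    cases x i <;> cases y i <;> simp [bitSign]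

lemma sum_walshCoeff_mul_walsh (h : (ι → Bool) → ℝ) (x : ι → Bool) :
    ∑ A, walshCoeff h A * walsh A x = h x := by
  simp only [walshCoeff, expect_mul]
  rw [← expect_sum_comm]
  have : ∀ y, ∑ A, h y * walsh A y * walsh A x
      = if y = x then h y * (Fintype.card (ι → Bool) : ℝ) else 0 := by
    intro y
    simp only [mul_assoc, ← mul_sum, sum_walsh_mul_walsh]
    split_ifs <;> simp
  simp only [this]
  rw [Fintype.expect_eq_sum_div_card, sum_ite_eq' univ x]
  have : (Fintype.card (ι → Bool) : ℝ) ≠ 0 := by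
    simp
  field_simp
  simp

lemma sum_walshCoeff_sq (h : (ι → Bool) → ℝ) : ∑ A, walshCoeff h A ^ 2 = 𝔼 x, h x ^ 2 := by
  rw [← expect_sum_walsh_sq]
  simp only [sum_walshCoeff_mul_walsh]

/-- **Bonami's inequality** in its `L⁴` form, proved by splitting off one bit at a time: the odd
powers of the sign of that bit have mean zero. -/
lemma expect_sum_walsh_pow_four_le (U : Finset ι) (c : Finset ι → ℝ) :
    𝔼 x, (∑ A ∈ U.powerset, c A * walsh A x) ^ 4
      ≤ (∑ A ∈ U.powerset, 3 ^ #A * c A ^ 2) ^ 2 := by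
  induction U using Finset.induction_on generalizing c with
  | empty => simp [walsh, ← pow_mul]
  | insert a U ha ih =>
    set p : (ι → Bool) → ℝ := fun x => ∑ A ∈ U.powerset, c A * walsh A x with hp
    set q : (ι → Bool) → ℝ := fun x => ∑ A ∈ U.powerset, c (insert a A) * walsh A x with hq
    have hnot : ∀ A ∈ U.powerset, a ∉ A := fun A hA h => ha (mem_powerset.1 hA h)
    have hsplit : ∀ x, ∑ A ∈ (insert a U).powerset, c A * walsh A x
        = p x + bitSign (x a) * q x := by
      intro x
      rw [sum_powerset_insert ha, hp, hq]
      simp only [mul_sum]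
      congr 1
      refine sum_congr rfl fun A hA => ?_
      rw [walsh, prod_insert (hnot A hA), walsh]
      ring
    have hpf : ∀ x, p (flipBit a x) = p x := by
      intro x
      refine sum_congr rfl fun A hA => ?_
      rw [walsh_flipBit, if_neg (hnot A hA)]
    have hqf : ∀ x, q (flipBit a x) = q x := by
      intro x
      refine sum_congr rfl fun A hA => ?_
      rw [walsh_flipBit, if_neg (hnot A hA)]
    have h1 := expect_flipBit a (fun x => (p x + bitSign (x a) * q x) ^ 4)
    have h2 : ∀ x, (p (flipBit a x) + bitSign (flipBit a x a) * q (flipBit a x)) ^ 4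
        = (p x - bitSign (x a) * q x) ^ 4 := by
      intro x
      rw [hpf, hqf]
      simp only [flipBit, Function.update_self, bitSign_not]
      ring
    simp only [h2] at h1
    have h3 : 𝔼 x, (p x + bitSign (x a) * q x) ^ 4
        = 𝔼 x, p x ^ 4 + 6 * 𝔼 x, p x ^ 2 * q x ^ 2 + 𝔼 x, q x ^ 4 := by
      have h4 : ∀ x, p x ^ 4 + 6 * (p x ^ 2 * q x ^ 2) + q x ^ 4
          = ((p x + bitSign (x a) * q x) ^ 4 + (p x - bitSign (x a) * q x) ^ 4) / 2 := by
        intro x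
        have e2 := bitSign_sq (x a)
        have e4 : bitSign (x a) ^ 4 = 1 := by
          rw [show (4 : ℕ) = 2 * 2 from rfl, pow_mul, e2, one_pow]
        linear_combination (-6 * p x ^ 2 * q x ^ 2) * e2 - q x ^ 4 * e4
      rw [mul_expect, ← expect_add_distrib, ← expect_add_distrib]
      simp only [h4]
      rw [← expect_div, expect_add_distrib, h1]
      ring
    simp only [hsplit]
    rw [h3]
    set α := ∑ A ∈ U.powerset, 3 ^ #A * c A ^ 2 with hα
    set β := ∑ A ∈ U.powerset, 3 ^ #A * c (insert a A) ^ 2 with hβ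
    have hα0 : 0 ≤ α := sum_nonneg fun A _ => by positivity
    have hβ0 : 0 ≤ β := sum_nonneg fun A _ => by positivity
    have ihp : 𝔼 x, p x ^ 4 ≤ α ^ 2 := ih c
    have ihq : 𝔼 x, q x ^ 4 ≤ β ^ 2 := ih fun A => c (insert a A)
    have hcs : 𝔼 x, p x ^ 2 * q x ^ 2 ≤ α * β := by
      have := expect_mul_sq_le_sq_mul_sq (univ : Finset (ι → Bool)) (fun x => p x ^ 2)
        (fun x => q x ^ 2)
      simp only [← pow_mul] at this
      refine abs_le_of_sq_le_sq' ?_ (by positivity) |>.2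
      calc _ ≤ (𝔼 x, p x ^ 4) * 𝔼 x, q x ^ 4 := this
        _ ≤ α ^ 2 * β ^ 2 := by
          refine mul_le_mul ihp ihq ?_ (by positivity)
          exact expect_nonneg fun x _ => by positivity
        _ = _ := by ring
    have hs : ∑ A ∈ (insert a U).powerset, 3 ^ #A * c A ^ 2 = α + 3 * β := by
      rw [sum_powerset_insert ha, hα, hβ, mul_sum]
      congr 1
      refine sum_congr rfl fun A hA => ?_
      rw [card_insert_of_notMem (hnot A hA)]
      ring
    rw [hs]
    nlinarith [sq_nonneg β]

/-- The discrete derivative in direction `i` acts on Walsh expansions by keeping the characters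
that contain `i`. -/
lemma walshCoeff_sub_flipBit (h : (ι → Bool) → ℝ) (i : ι) (A : Finset ι) :
    walshCoeff (fun x => (h x - h (flipBit i x)) / 2) A = if i ∈ A then walshCoeff h A else 0 := by
  have h1 : 𝔼 x, h (flipBit i x) * walsh A x = 𝔼 x, h x * walsh A (flipBit i x) := by
    rw [← expect_flipBit i]
    simp only [flipBit_flipBit]
  have h2 : walshCoeff (fun x => (h x - h (flipBit i x)) / 2) A
      = (𝔼 x, h x * walsh A x - 𝔼 x, h x * walsh A (flipBit i x)) / 2 := by
    rw [← h1, ← expect_sub_distrib, expect_div, walshCoeff]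
    refine expect_congr rfl fun x _ => by ring
  rw [h2]
  simp only [walsh_flipBit]
  split_ifs with hA
  · simp only [mul_neg, expect_neg_distrib, walshCoeff]
    ring
  · simp

/-- The influence `E|h(x) - h(x ⊕ e_i)|` of the `i`-th bit. -/
noncomputable def bitInfluence (h : (ι → Bool) → ℝ) (i : ι) : ℝ := 𝔼 x, |h x - h (flipBit i x)|

lemma bitInfluence_nonneg (h : (ι → Bool) → ℝ) (i : ι) : 0 ≤ bitInfluence h i :=
  expect_nonneg fun _ _ => abs_nonneg _

lemma expect_halfDiff_sq_le {h : (ι → Bool) → ℝ} {M : ℝ} (hM : ∀ x, |h x| ≤ M) (i : ι) :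
    𝔼 x, ((h x - h (flipBit i x)) / 2) ^ 2 ≤ M * bitInfluence h i := by
  rw [bitInfluence, mul_expect]
  refine expect_le_expect fun x _ => ?_
  rw [← sq_abs, abs_div, abs_two]
  have h1 : |h x - h (flipBit i x)| ≤ 2 * M :=
    (abs_sub _ _).trans (by linarith [hM x, hM (flipBit i x)])
  nlinarith [abs_nonneg (h x - h (flipBit i x))]

/-- The part of the Walsh spectrum of degree at least `d` is controlled by the total influence. -/
lemma sum_walshCoeff_sq_high_le {h : (ι → Bool) → ℝ} {M K : ℝ} (hM : ∀ x, |h x| ≤ M)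
    (hM0 : 0 ≤ M) (hK : ∑ i, bitInfluence h i ≤ K) (d : ℕ) :
    d * ∑ A with d ≤ #A, walshCoeff h A ^ 2 ≤ M * K := by
  calc (d : ℝ) * ∑ A with d ≤ #A, walshCoeff h A ^ 2
      ≤ ∑ A with d ≤ #A, (#A : ℝ) * walshCoeff h A ^ 2 := by
        rw [mul_sum]
        refine sum_le_sum fun A hA => ?_
        have : (d : ℝ) ≤ #A := by exact_mod_cast (mem_filter.1 hA).2
        gcongr
    _ ≤ ∑ A, (#A : ℝ) * walshCoeff h A ^ 2 :=
        sum_le_sum_of_subset_of_nonneg (filter_subset _ _) fun A _ _ => by positivity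
    _ = ∑ i, ∑ A, (if i ∈ A then walshCoeff h A else 0) ^ 2 := by
        rw [sum_comm]
        refine sum_congr rfl fun A _ => ?_
        simp [ite_pow]
    _ = ∑ i, 𝔼 x, ((h x - h (flipBit i x)) / 2) ^ 2 := by
        refine sum_congr rfl fun i _ => ?_
        rw [← sum_walshCoeff_sq]
        simp only [walshCoeff_sub_flipBit]
    _ ≤ ∑ i, M * bitInfluence h i := sum_le_sum fun i _ => expect_halfDiff_sq_le hM i
    _ ≤ M * K := by rw [← mul_sum]; gcongr

/-- The low-degree characters containing `i` carry a mass of order `I_i^{3/2}` only: this is where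
hypercontractivity gains over the trivial bound of order `I_i`. -/
lemma sum_walshCoeff_sq_low_le {h : (ι → Bool) → ℝ} {M : ℝ} (hM : ∀ x, |h x| ≤ M)
    (hM0 : 0 ≤ M) (i : ι) (d : ℕ) :
    ∑ A with i ∈ A ∧ #A < d, walshCoeff h A ^ 2
      ≤ 3 ^ d * (bitInfluence h i * √(M * bitInfluence h i)) := by
  set D : (ι → Bool) → ℝ := fun x => (h x - h (flipBit i x)) / 2 with hD
  set c : Finset ι → ℝ := fun A => if i ∈ A ∧ #A < d then walshCoeff h A else 0 with hc
  set P : (ι → Bool) → ℝ := fun x => ∑ A, c A * walsh A x with hP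
  set I := bitInfluence h i with hI
  have hI0 : 0 ≤ I := bitInfluence_nonneg h i
  set s := ∑ A with i ∈ A ∧ #A < d, walshCoeff h A ^ 2 with hs
  have hs' : s = ∑ A, c A ^ 2 := by
    simp only [hs, hc, ite_pow, sum_filter]
    simp
  have hs0 : 0 ≤ s := sum_nonneg fun A _ => sq_nonneg _
  have hDP : 𝔼 x, D x * P x = s := by
    have : ∀ x, D x = ∑ A, walshCoeff D A * walsh A x :=
      fun x => (sum_walshCoeff_mul_walsh D x).symm
    simp only [this, hP]
    rw [expect_sum_walsh_mul_sum_walsh, hs']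
    refine sum_congr rfl fun A _ => ?_
    simp only [hD, walshCoeff_sub_flipBit, hc]
    by_cases h1 : i ∈ A <;> by_cases h2 : #A < d <;> simp [h1, h2, sq]
  have hP4 : 𝔼 x, P x ^ 4 ≤ (3 ^ d * s) ^ 2 := by
    have := expect_sum_walsh_pow_four_le univ c
    rw [powerset_univ] at this
    refine this.trans ?_
    have h0 : 0 ≤ ∑ A, 3 ^ #A * c A ^ 2 := sum_nonneg fun A _ => by positivity
    refine pow_le_pow_left₀ h0 ?_ 2
    rw [hs', mul_sum]
    refine sum_le_sum fun A _ => ?_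
    by_cases h1 : i ∈ A ∧ #A < d
    · gcongr
      · norm_num
      · exact h1.2.le
    · simp [hc, h1]
  have hD1 : 𝔼 x, |D x| ≤ I := by
    rw [hI, bitInfluence]
    refine expect_le_expect fun x _ => ?_
    rw [hD, abs_div, abs_two]
    linarith [abs_nonneg (h x - h (flipBit i x))]
  have hD2 : 𝔼 x, D x ^ 2 ≤ M * I := expect_halfDiff_sq_le hM i
  -- Cauchy–Schwarz twice: `⟨D, P⟩² ≤ E|D| · E|D|P²` and `(E|D|P²)² ≤ ED² · EP⁴`.
  have hcs1 : s ^ 2 ≤ I * 𝔼 x, |D x| * P x ^ 2 := by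
    have := expect_mul_sq_le_sq_mul_sq (univ : Finset (ι → Bool)) (fun x => √|D x|)
      (fun x => √|D x| * |P x|)
    have e1 : ∀ x, √|D x| * (√|D x| * |P x|) = |D x * P x| := fun x => by
      rw [← mul_assoc, Real.mul_self_sqrt (abs_nonneg _), abs_mul]
    have e2 : ∀ x, (√|D x| * |P x|) ^ 2 = |D x| * P x ^ 2 := fun x => by
      rw [mul_pow, Real.sq_sqrt (abs_nonneg _), sq_abs]
    have e3 : ∀ x, √|D x| ^ 2 = |D x| := fun x => Real.sq_sqrt (abs_nonneg _)
    simp only [e1, e2, e3] at this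
    have h0 : 0 ≤ 𝔼 x, |D x| * P x ^ 2 := expect_nonneg fun x _ => by positivity
    calc s ^ 2 ≤ (𝔼 x, |D x * P x|) ^ 2 := by
          refine pow_le_pow_left₀ hs0 ?_ 2
          rw [← hDP]
          exact expect_le_expect fun x _ => le_abs_self _
      _ ≤ _ := this
      _ ≤ _ := by gcongr
  have hcs2 : 𝔼 x, |D x| * P x ^ 2 ≤ √(M * I) * (3 ^ d * s) := by
    have := expect_mul_sq_le_sq_mul_sq (univ : Finset (ι → Bool)) (fun x => |D x|)
      (fun x => P x ^ 2)
    simp only [← pow_mul, sq_abs] at this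
    have h0 : 0 ≤ √(M * I) * (3 ^ d * s) := by positivity
    refine (abs_le_of_sq_le_sq' ?_ h0).2
    calc _ ≤ _ := this
      _ ≤ (M * I) * (3 ^ d * s) ^ 2 := by
        refine mul_le_mul hD2 hP4 ?_ (mul_nonneg hM0 hI0)
        exact expect_nonneg fun x _ => Even.pow_nonneg (by decide) _
      _ = _ := by rw [mul_pow √(M * I), Real.sq_sqrt (mul_nonneg hM0 hI0)]
  rcases hs0.eq_or_lt with h0 | hpos
  · rw [← h0]; positivity
  · have : s * s ≤ (3 ^ d * (I * √(M * I))) * s := by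
      calc s * s = s ^ 2 := (sq s).symm
        _ ≤ I * (√(M * I) * (3 ^ d * s)) := hcs1.trans (by gcongr)
        _ = _ := by ring
    exact le_of_mul_le_mul_right this hpos

/-- **Friedgut's junta theorem** for bounded real functions on the Boolean cube: discarding the
characters that meet a bit of influence less than `δ` costs little in `L²`. -/
theorem exists_junta_boolean {h : (ι → Bool) → ℝ} {M K δ : ℝ} (hM : ∀ x, |h x| ≤ M)
    (hK : ∑ i, bitInfluence h i ≤ K) (d : ℕ) (hd : 0 < d) :
    ∃ (J : Finset ι) (g : (ι → Bool) → ℝ), δ * #J ≤ K ∧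
      (∀ x y, (∀ i ∈ J, x i = y i) → g x = g y) ∧
      (𝔼 x, |h x - g x|) ^ 2 ≤ M * K / d + 3 ^ d * K * √(M * δ) := by
  have hM0 : 0 ≤ M := (abs_nonneg _).trans (hM fun _ => false)
  set J : Finset ι := {i | δ ≤ bitInfluence h i} with hJ
  refine ⟨J, fun x => ∑ A with A ⊆ J, walshCoeff h A * walsh A x, ?_, ?_, ?_⟩
  · calc δ * #J = ∑ i ∈ J, δ := by rw [sum_const, nsmul_eq_mul, mul_comm]
      _ ≤ ∑ i ∈ J, bitInfluence h i := sum_le_sum fun i hi => (mem_filter.1 hi).2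
      _ ≤ ∑ i, bitInfluence h i :=
        sum_le_sum_of_subset_of_nonneg (subset_univ _) fun i _ _ => bitInfluence_nonneg h i
      _ ≤ K := hK
  · intro x y hxy
    refine sum_congr rfl fun A hA => ?_
    congr 1
    exact prod_congr rfl fun i hi => by rw [hxy i ((mem_filter.1 hA).2 hi)]
  · have hdiff : ∀ x, h x - ∑ A with A ⊆ J, walshCoeff h A * walsh A x
        = ∑ A with ¬ A ⊆ J, walshCoeff h A * walsh A x := by
      intro x
      rw [← sum_walshCoeff_mul_walsh h x, ← sum_filter_add_sum_filter_not univ (· ⊆ J)]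
      ring
    simp only [hdiff]
    have h1 := expect_mul_sq_le_sq_mul_sq (univ : Finset (ι → Bool))
      (fun x => |∑ A with ¬ A ⊆ J, walshCoeff h A * walsh A x|) (fun _ => 1)
    simp only [mul_one, sq_abs, one_pow, Fintype.expect_one, expect_sum_walsh_sq] at h1
    refine h1.trans ?_
    have hI : ∀ i ∈ Jᶜ, bitInfluence h i ≤ δ := fun i hi => by
      simp only [hJ, mem_compl, mem_filter, mem_univ, true_and, not_le] at hi
      exact hi.le
    have hhigh : ∑ A with d ≤ #A, walshCoeff h A ^ 2 ≤ M * K / d := by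
      rw [le_div_iff₀ (by exact_mod_cast hd), mul_comm]
      exact sum_walshCoeff_sq_high_le hM hM0 hK d
    have hlow : ∑ i ∈ Jᶜ, ∑ A with i ∈ A ∧ #A < d, walshCoeff h A ^ 2
        ≤ 3 ^ d * K * √(M * δ) := by
      calc _ ≤ ∑ i ∈ Jᶜ, 3 ^ d * (bitInfluence h i * √(M * δ)) := by
            refine sum_le_sum fun i hi => (sum_walshCoeff_sq_low_le hM hM0 i d).trans ?_
            have := bitInfluence_nonneg h i
            have := hI i hi
            gcongr
        _ = 3 ^ d * (∑ i ∈ Jᶜ, bitInfluence h i) * √(M * δ) := by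
            rw [mul_sum, sum_mul]
            refine sum_congr rfl fun i _ => by ring
        _ ≤ 3 ^ d * K * √(M * δ) := by
            gcongr
            exact (sum_le_sum_of_subset_of_nonneg (subset_univ _)
              fun i _ _ => bitInfluence_nonneg h i).trans hK
    refine le_trans ?_ (add_le_add hhigh hlow)
    -- A character outside `J` has degree at least `d`, or smaller degree and contains some `i ∉ J`.
    simp only [sum_filter]
    rw [sum_comm, ← sum_add_distrib]
    refine sum_le_sum fun A _ => ?_
    have hterm : ∀ i ∈ Jᶜ, 0 ≤ if i ∈ A ∧ #A < d then walshCoeff h A ^ 2 else 0 :=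
      fun i _ => by positivity
    split_ifs with h2 h3 h3
    · exact add_nonneg (sq_nonneg _) (sum_nonneg hterm)
    · exact add_nonneg le_rfl (sum_nonneg hterm)
    · exact le_add_of_nonneg_right (sum_nonneg hterm)
    · obtain ⟨i, hiA, hiJ⟩ := not_subset.1 h2
      rw [zero_add]
      refine (single_le_sum hterm (mem_compl.2 hiJ)).trans' ?_
      rw [if_pos ⟨hiA, not_le.1 h3⟩]

end BooleanCube

/-! ### Juntas on dyadic grids -/

section DyadicGrid

open Finset
open scoped BigOperators

/-- Binary expansion, as a bijection between `k` bits and the integers below `2 ^ k`. -/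
def binaryEquiv (k : ℕ) : (Fin k → Bool) ≃ Fin (2 ^ k) :=
  (Equiv.arrowCongr (Equiv.refl _) finTwoEquiv.symm).trans finFunctionFinEquiv

lemma binaryEquiv_val {k : ℕ} (b : Fin k → Bool) :
    (binaryEquiv k b : ℕ) = ∑ i, if b i then 2 ^ (i : ℕ) else 0 := by
  simp only [binaryEquiv, Equiv.trans_apply, finFunctionFinEquiv_apply]
  refine sum_congr rfl fun i _ => ?_
  cases h : b i <;> simp [Equiv.arrowCongr, finTwoEquiv, h]

/-- Changing the `i`-th binary digit of an integer below `2 ^ k`. -/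
def flipDigit {k : ℕ} (i : Fin k) (t : Fin (2 ^ k)) : Fin (2 ^ k) :=
  binaryEquiv k (flipBit i ((binaryEquiv k).symm t))

lemma flipDigit_val {k : ℕ} (i : Fin k) (t : Fin (2 ^ k)) :
    (flipDigit i t : ℕ) = t + 2 ^ (i : ℕ) ∨ (t : ℕ) = flipDigit i t + 2 ^ (i : ℕ) := by
  obtain ⟨b, rfl⟩ := (binaryEquiv k).surjective t
  rw [flipDigit, Equiv.symm_apply_apply, binaryEquiv_val, binaryEquiv_val,
    ← add_sum_erase _ _ (mem_univ i), ← add_sum_erase (f := fun j => if b j then 2 ^ (j : ℕ) else 0)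
      _ (mem_univ i)]
  have : ∑ j ∈ univ.erase i, (if flipBit i b j then 2 ^ (j : ℕ) else 0)
      = ∑ j ∈ univ.erase i, if b j then 2 ^ (j : ℕ) else 0 := by
    refine sum_congr rfl fun j hj => ?_
    rw [flipBit, Function.update_of_ne (ne_of_mem_erase hj)]
  rw [this]
  cases h : b i
  · left; simp [flipBit, h, add_comm]
  · right; simp [flipBit, h, add_comm]

/-- Changing the `i`-th digit moves a point by `2 ^ i`, so each unit step is crossed at most
`2 * 2 ^ i` times. -/
lemma sum_abs_sub_flipDigit_le {k : ℕ} (i : Fin k) (a : ℕ → ℝ) :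
    ∑ t : Fin (2 ^ k), |a t - a (flipDigit i t)|
      ≤ 2 * 2 ^ (i : ℕ) * ∑ j ∈ range (2 ^ k - 1), |a (j + 1) - a j| := by
  have hterm : ∀ p q : ℕ, q < 2 ^ k → q = p + 2 ^ (i : ℕ) → |a p - a q|
      ≤ ∑ j ∈ range (2 ^ k - 1) with p ≤ j ∧ j < q, |a (j + 1) - a j| := by
    intro p q hq hpq
    have h1 := dist_le_Ico_sum_dist a (hpq ▸ Nat.le_add_right p _ : p ≤ q)
    rw [Real.dist_eq] at h1
    refine h1.trans (le_of_eq ?_)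
    refine sum_congr ?_ fun j _ => by rw [Real.dist_eq, abs_sub_comm]
    ext j
    simp only [mem_Ico, mem_filter, mem_range]
    omega
  have hterm' : ∀ t : Fin (2 ^ k), |a t - a (flipDigit i t)|
      ≤ ∑ j ∈ range (2 ^ k - 1) with j < (t : ℕ) + 2 ^ (i : ℕ) ∧ (t : ℕ) ≤ j + 2 ^ (i : ℕ),
        |a (j + 1) - a j| := by
    intro t
    have h1 := (flipDigit i t).isLt
    have h2 := t.isLt
    rcases flipDigit_val i t with h | h
    · refine (hterm _ _ h1 h).trans (sum_le_sum_of_subset_of_nonneg ?_ fun _ _ _ => abs_nonneg _)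
      intro j
      simp only [mem_filter, mem_range]
      omega
    · rw [abs_sub_comm]
      refine (hterm _ _ h2 h).trans (sum_le_sum_of_subset_of_nonneg ?_ fun _ _ _ => abs_nonneg _)
      intro j
      simp only [mem_filter, mem_range]
      omega
  refine (sum_le_sum fun t _ => hterm' t).trans ?_
  simp only [sum_filter]
  rw [sum_comm, mul_sum]
  refine sum_le_sum fun j _ => ?_
  rw [← sum_filter, sum_const, nsmul_eq_mul]
  refine mul_le_mul_of_nonneg_right ?_ (abs_nonneg _)
  have hcard : #{t : Fin (2 ^ k) | j < (t : ℕ) + 2 ^ (i : ℕ) ∧ (t : ℕ) ≤ j + 2 ^ (i : ℕ)}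
      ≤ #(Ioc j (j + 2 * 2 ^ (i : ℕ))) := by
    refine card_le_card_of_injOn (fun t => (t : ℕ) + 2 ^ (i : ℕ)) ?_ ?_
    · intro t ht
      simp only [coe_filter, mem_univ, true_and, Set.mem_ofPred_eq] at ht
      simp only [coe_Ioc, Set.mem_Ioc]
      omega
    · intro s _ t _ hst
      simp only at hst
      exact Fin.ext (by omega)
  rw [Nat.card_Ioc, Nat.add_sub_cancel_left] at hcard
  exact_mod_cast hcard

/-- Resampling one coordinate of a uniform point of a finite power leaves it uniform. -/
lemma expect_expect_update {N : ℕ} {α : Type*} [Fintype α] [Nonempty α]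
    (n : Fin N) (F : (Fin N → α) → ℝ) :
    𝔼 c, 𝔼 t, F (Function.update c n t) = 𝔼 c, F c := by
  let e : (Fin N → α) × α → (Fin N → α) × α := fun p => (Function.update p.1 n p.2, p.1 n)
  have he : Function.Involutive e := fun p => by simp [e]
  have h1 : 𝔼 p : (Fin N → α) × α, F (e p).1 = 𝔼 p : (Fin N → α) × α, F p.1 :=
    Fintype.expect_bijective e he.bijective _ _ fun _ => rfl
  rw [← univ_product_univ, expect_product, expect_product] at h1
  simpa [e] using h1

variable {N k : ℕ}

/-- Bit strings indexed by pairs (coordinate, binary digit) encode the points of the dyadic grid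
`{0, …, 2 ^ k - 1}^N`. -/
def gridEquiv (k N : ℕ) : (Fin N × Fin k → Bool) ≃ (Fin N → Fin (2 ^ k)) :=
  (Equiv.curry _ _ _).trans (Equiv.piCongrRight fun _ => binaryEquiv k)

lemma gridEquiv_apply (b : Fin N × Fin k → Bool) (n : Fin N) :
    gridEquiv k N b n = binaryEquiv k fun i => b (n, i) := rfl

lemma gridEquiv_flipBit (n : Fin N) (i : Fin k) (b : Fin N × Fin k → Bool) :
    gridEquiv k N (flipBit (n, i) b)
      = Function.update (gridEquiv k N b) n (flipDigit i (gridEquiv k N b n)) := by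
  ext1 n'
  rcases eq_or_ne n' n with rfl | hn
  · rw [Function.update_self, flipDigit, gridEquiv_apply, gridEquiv_apply,
      Equiv.symm_apply_apply]
    congr 1
    ext j
    simp [flipBit, Function.update_apply]
  · rw [Function.update_of_ne hn, gridEquiv_apply, gridEquiv_apply]
    congr 1
    ext j
    simp [flipBit, hn]

/-- The mean total variation along the `n`-th coordinate of a function on the grid
`{0, …, 2 ^ k - 1}^N`. -/
noncomputable def gridVariation (k : ℕ) {N : ℕ} (G : (Fin N → ℕ) → ℝ) (n : Fin N) : ℝ :=
  𝔼 c : Fin N → Fin (2 ^ k), ∑ j ∈ range (2 ^ k - 1),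
    |G (Function.update (fun l => (c l : ℕ)) n (j + 1))
      - G (Function.update (fun l => (c l : ℕ)) n j)|

lemma gridVariation_nonneg (k : ℕ) (G : (Fin N → ℕ) → ℝ) (n : Fin N) :
    0 ≤ gridVariation k G n :=
  expect_nonneg fun _ _ => sum_nonneg fun _ _ => abs_nonneg _

lemma update_val_comp {m : ℕ} (c : Fin N → Fin m) (n : Fin N) (t : Fin m) :
    (fun l => (Function.update c n t l : ℕ)) = Function.update (fun l => (c l : ℕ)) n t := by
  ext l
  rcases eq_or_ne l n with rfl | hl <;> simp [*]

/-- The influence of the digit of weight `2 ^ i` is smaller than the variation by a factor of order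
`2 ^ i / 2 ^ k`. -/
lemma bitInfluence_grid_le (G : (Fin N → ℕ) → ℝ) (n : Fin N) (i : Fin k) :
    bitInfluence (fun b => G fun l => (gridEquiv k N b l : ℕ)) (n, i)
      ≤ 2 * 2 ^ (i : ℕ) / 2 ^ k * gridVariation k G n := by
  have h1 : bitInfluence (fun b => G fun l => (gridEquiv k N b l : ℕ)) (n, i)
      = 𝔼 c : Fin N → Fin (2 ^ k), |G (fun l => (c l : ℕ))
        - G (fun l => (Function.update c n (flipDigit i (c n)) l : ℕ))| := by
    refine Fintype.expect_equiv (gridEquiv k N) _ _ fun b => ?_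
    simp only [gridEquiv_flipBit]
  rw [h1, ← expect_expect_update n, gridVariation, mul_expect]
  refine expect_le_expect fun c _ => ?_
  simp only [Function.update_idem, Function.update_self, update_val_comp]
  have h2 := sum_abs_sub_flipDigit_le i
    fun j => G (Function.update (fun l => (c l : ℕ)) n j)
  rw [Fintype.expect_eq_sum_div_card, Fintype.card_fin, Nat.cast_pow, Nat.cast_ofNat,
    div_le_iff₀ (by positivity)]
  refine h2.trans (le_of_eq ?_)
  field_simp

lemma sum_bitInfluence_grid_le (G : (Fin N → ℕ) → ℝ) {K : ℝ}
    (hK : ∑ n, gridVariation k G n ≤ K) :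
    ∑ p, bitInfluence (fun b => G fun l => (gridEquiv k N b l : ℕ)) p ≤ 2 * K := by
  rw [Fintype.sum_prod_type]
  calc _ ≤ ∑ n, ∑ i : Fin k, 2 * 2 ^ (i : ℕ) / 2 ^ k * gridVariation k G n :=
        sum_le_sum fun n _ => sum_le_sum fun i _ => bitInfluence_grid_le G n i
    _ ≤ ∑ n, 2 * gridVariation k G n := by
        refine sum_le_sum fun n _ => ?_
        rw [← sum_mul]
        refine mul_le_mul_of_nonneg_right ?_ (gridVariation_nonneg k G n)
        rw [← sum_div, ← mul_sum, div_le_iff₀ (by positivity),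
          Fin.sum_univ_eq_sum_range (fun i => (2 : ℝ) ^ i) k, geom_sum_eq (by norm_num)]
        norm_num
    _ ≤ 2 * K := by rw [← mul_sum]; linarith

/-- Friedgut's junta theorem on a dyadic grid, with bounds that do not depend on its mesh. -/
theorem exists_junta_grid (k : ℕ) (G : (Fin N → ℕ) → ℝ) {M K δ : ℝ} (hM : ∀ c, |G c| ≤ M)
    (hK : ∑ n, gridVariation k G n ≤ K) (hδ : 0 ≤ δ) (d : ℕ) (hd : 0 < d) :
    ∃ (S : Finset (Fin N)) (g : (Fin N → Fin (2 ^ k)) → ℝ), δ * #S ≤ 2 * K ∧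
      (∀ c c', (∀ n ∈ S, c n = c' n) → g c = g c') ∧
      (𝔼 c : Fin N → Fin (2 ^ k), |G (fun l => (c l : ℕ)) - g c|) ^ 2
        ≤ M * (2 * K) / d + 3 ^ d * (2 * K) * √(M * δ) := by
  obtain ⟨J, g, hJ, hg, hle⟩ := exists_junta_boolean (δ := δ)
    (fun b => hM fun l => (gridEquiv k N b l : ℕ)) (sum_bitInfluence_grid_le G hK) d hd
  refine ⟨J.image Prod.fst, fun c => g ((gridEquiv k N).symm c), ?_, ?_, ?_⟩
  · refine le_trans ?_ hJ
    gcongr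
    exact card_image_le
  · intro c c' hcc
    refine hg _ _ fun p hp => ?_
    have h1 : ∀ c : Fin N → Fin (2 ^ k), (gridEquiv k N).symm c p
        = (binaryEquiv k).symm (c p.1) p.2 := fun _ => rfl
    rw [h1, h1, hcc p.1 (mem_image_of_mem _ hp)]
  · refine le_trans (le_of_eq ?_) hle
    congr 1
    symm
    refine Fintype.expect_equiv (gridEquiv k N) _ _ fun b => ?_
    simp only [Equiv.symm_apply_apply]

end DyadicGrid

/-! ### Dyadic cells of the unit cube -/

section CubeCells

open scoped BigOperators

instance : IsProbabilityMeasure lebUnit := ⟨by simp⟩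

lemma powMeasure_lebUnit (N : ℕ) :
    powMeasure lebUnit N = volume.restrict (Set.Icc (0 : Fin N → ℝ) 1) := by
  rw [powMeasure, ← Measure.restrict_pi_pi, ← volume_pi, ← Set.pi_univ_Icc]
  rfl

/-- The index of the dyadic interval `[j / 2 ^ k, (j + 1) / 2 ^ k)` containing `t ∈ [0, 1]`; the
endpoint `1` is assigned to the last interval. -/
noncomputable def dyadicCell (k : ℕ) (t : ℝ) : Fin (2 ^ k) :=
  ⟨min ⌊2 ^ k * t⌋₊ (2 ^ k - 1), by have := Nat.two_pow_pos k; omega⟩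

lemma measurable_dyadicCell (k : ℕ) : Measurable (dyadicCell k) := by
  have h1 : Measurable fun t : ℝ => ⌊2 ^ k * t⌋₊ := (measurable_const_mul _).nat_floor
  have h2 : Measurable fun j : ℕ =>
      (⟨min j (2 ^ k - 1), by have := Nat.two_pow_pos k; omega⟩ : Fin (2 ^ k)) :=
    Measurable.of_discrete
  exact h2.comp h1

lemma abs_sub_dyadicCell_le (k : ℕ) {t : ℝ} (ht : t ∈ Set.Icc (0 : ℝ) 1) :
    |t - (dyadicCell k t : ℕ) / 2 ^ k| ≤ 1 / 2 ^ k := by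
  have hpos : (0 : ℝ) < 2 ^ k := by positivity
  have hnn : 0 ≤ 2 ^ k * t := mul_nonneg hpos.le ht.1
  have h1 := Nat.floor_le hnn
  have h2 := Nat.lt_floor_add_one (2 ^ k * t)
  have h3 : 2 ^ k * t ≤ 2 ^ k := by nlinarith [ht.2]
  have h4 : |2 ^ k * t - ((dyadicCell k t : ℕ) : ℝ)| ≤ 1 := by
    have hp := Nat.two_pow_pos k
    simp only [dyadicCell]
    rcases le_total ⌊2 ^ k * t⌋₊ (2 ^ k - 1) with h | h
    · rw [min_eq_left h, abs_le]
      constructor <;> linarith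
    · rw [min_eq_right h]
      have h5 : ((2 ^ k - 1 : ℕ) : ℝ) = 2 ^ k - 1 := by
        rw [Nat.cast_sub hp]; simp
      have h6 : ((2 ^ k - 1 : ℕ) : ℝ) ≤ ⌊2 ^ k * t⌋₊ := by exact_mod_cast h
      rw [abs_le]
      constructor <;> linarith
  have h5 : t - (dyadicCell k t : ℕ) / 2 ^ k
      = (2 ^ k * t - ((dyadicCell k t : ℕ) : ℝ)) / 2 ^ k := by
    field_simp
  rw [h5, abs_div, abs_of_pos hpos]
  gcongr

lemma lebUnit_dyadicCell_preimage (k : ℕ) (j : Fin (2 ^ k)) :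
    lebUnit (dyadicCell k ⁻¹' {j}) = ENNReal.ofReal ((2 ^ k : ℝ)⁻¹) := by
  have hpos : (0 : ℝ) < 2 ^ k := by positivity
  have hj : ((j : ℕ) : ℝ) + 1 ≤ 2 ^ k := by exact_mod_cast j.isLt
  have h1 : lebUnit = volume.restrict (Set.Ico (0 : ℝ) 1) :=
    Measure.restrict_congr_set Ico_ae_eq_Icc.symm
  rw [h1, Measure.restrict_apply (measurable_dyadicCell k (measurableSet_singleton j))]
  have h2 : dyadicCell k ⁻¹' {j} ∩ Set.Ico (0 : ℝ) 1
      = Set.Ico ((j : ℕ) / 2 ^ k : ℝ) (((j : ℕ) + 1) / 2 ^ k) := by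
    ext t
    have hfl : t ∈ Set.Ico (0 : ℝ) 1 → (dyadicCell k t : ℕ) = ⌊2 ^ k * t⌋₊ := by
      intro ht
      have : ⌊2 ^ k * t⌋₊ < 2 ^ k := by
        rw [Nat.floor_lt (mul_nonneg hpos.le ht.1)]
        push_cast
        nlinarith [ht.2]
      simp only [dyadicCell]
      omega
    simp only [Set.mem_inter_iff, Set.mem_preimage, Set.mem_singleton_iff]
    constructor
    · rintro ⟨rfl, ht⟩
      rw [hfl ht, Set.mem_Ico, div_le_iff₀ hpos, lt_div_iff₀ hpos, mul_comm t]
      exact ⟨Nat.floor_le (mul_nonneg hpos.le ht.1), Nat.lt_floor_add_one _⟩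
    · intro ht
      have ht' : t ∈ Set.Ico (0 : ℝ) 1 :=
        ⟨le_trans (by positivity) ht.1, ht.2.trans_le ((div_le_one hpos).2 hj)⟩
      refine ⟨Fin.ext ?_, ht'⟩
      rw [hfl ht', Nat.floor_eq_iff (mul_nonneg hpos.le ht'.1)]
      rw [Set.mem_Ico, div_le_iff₀ hpos, lt_div_iff₀ hpos, mul_comm t] at ht
      exact ht
  rw [h2, Real.volume_Ico]
  congr 1
  field_simp
  ring

variable {N : ℕ}

/-- The cell of the dyadic grid on `[0, 1]^N` that contains a point. -/
noncomputable def gridCell (k : ℕ) (x : Fin N → ℝ) : Fin N → Fin (2 ^ k) :=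
  fun n => dyadicCell k (x n)

lemma measurable_gridCell (k : ℕ) : Measurable (gridCell k : (Fin N → ℝ) → _) :=
  measurable_pi_lambda _ fun n => (measurable_dyadicCell k).comp (measurable_pi_apply n)

lemma integral_comp_gridCell (k : ℕ) (g : (Fin N → Fin (2 ^ k)) → ℝ) :
    ∫ x, g (gridCell k x) ∂(powMeasure lebUnit N) = 𝔼 c, g c := by
  have h0 : ∀ c : Fin N → Fin (2 ^ k),
      ((powMeasure lebUnit N).map (gridCell k)).real {c} = ((2 ^ k : ℝ)⁻¹) ^ N := by
    intro c
    rw [measureReal_def, Measure.map_apply (measurable_gridCell k) (measurableSet_singleton c)]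
    have h1 : gridCell k ⁻¹' {c} = Set.univ.pi fun n => dyadicCell k ⁻¹' {c n} := by
      ext x
      simp [gridCell, funext_iff]
    rw [h1, powMeasure, Measure.pi_pi]
    simp only [lebUnit_dyadicCell_preimage]
    rw [Finset.prod_const, Finset.card_univ, Fintype.card_fin, ENNReal.toReal_pow,
      ENNReal.toReal_ofReal (by positivity)]
  rw [← integral_map (measurable_gridCell k).aemeasurable
    (Measurable.of_discrete.aestronglyMeasurable), integral_fintype .of_finite]
  simp only [h0, smul_eq_mul]
  rw [← Finset.mul_sum, Fintype.expect_eq_sum_div_card, div_eq_inv_mul]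
  congr 1
  simp

/-- The corner of a cell of the dyadic grid. -/
noncomputable def gridPoint (k : ℕ) (c : Fin N → ℕ) : Fin N → ℝ := fun n => c n / 2 ^ k

lemma gridPoint_mem (k : ℕ) {c : Fin N → ℕ} (hc : ∀ n, c n ≤ 2 ^ k) :
    gridPoint k c ∈ Set.Icc (0 : Fin N → ℝ) 1 := by
  refine ⟨fun n => ?_, fun n => ?_⟩
  · simp only [gridPoint, Pi.zero_apply]; positivity
  · simp only [gridPoint, Pi.one_apply]
    rw [div_le_one (by positivity)]
    exact_mod_cast hc n

lemma gridPoint_update (k : ℕ) (c : Fin N → ℕ) (n : Fin N) (j : ℕ) :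
    gridPoint k (Function.update c n j) = Function.update (gridPoint k c) n (j / 2 ^ k : ℝ) := by
  ext l
  rcases eq_or_ne l n with rfl | hl <;> simp [gridPoint, *]

lemma dist_gridPoint_gridCell_le (k : ℕ) {x : Fin N → ℝ} (hx : x ∈ Set.Icc (0 : Fin N → ℝ) 1) :
    dist x (gridPoint k fun l => (gridCell k x l : ℕ)) ≤ 1 / 2 ^ k := by
  refine (dist_pi_le_iff (by positivity)).2 fun n => ?_
  rw [Real.dist_eq]
  exact abs_sub_dyadicCell_le k ⟨hx.1 n, hx.2 n⟩

lemma integrable_of_continuousOn_cube {F : (Fin N → ℝ) → ℝ}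
    (hF : ContinuousOn F (Set.Icc 0 1)) : Integrable F (powMeasure lebUnit N) := by
  rw [powMeasure_lebUnit]
  exact hF.integrableOn_compact isCompact_Icc

lemma ae_mem_cube (N : ℕ) : ∀ᵐ x ∂(powMeasure lebUnit N), x ∈ Set.Icc (0 : Fin N → ℝ) 1 := by
  rw [powMeasure_lebUnit]
  exact ae_restrict_mem measurableSet_Icc

lemma update_mem_cube {x : Fin N → ℝ} (hx : x ∈ Set.Icc (0 : Fin N → ℝ) 1) (n : Fin N) {t : ℝ}
    (ht : t ∈ Set.Icc (0 : ℝ) 1) : Function.update x n t ∈ Set.Icc (0 : Fin N → ℝ) 1 := by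
  refine ⟨fun l => ?_, fun l => ?_⟩ <;> rcases eq_or_ne l n with rfl | hl
  · simpa using ht.1
  · simpa [hl] using hx.1 l
  · simpa using ht.2
  · simpa [hl] using hx.2 l

/-- Along a fine grid, the mean variation of `φ` in the `n`-th direction is at most
`‖∂_n φ‖_1`, up to the modulus of continuity of the derivative at the scale of the grid. -/
lemma gridVariation_le {φ F D : (Fin N → ℝ) → ℝ} (n : Fin N) (k : ℕ) {η : ℝ}
    (hφ : ∀ x y, |φ x - φ y| ≤ |F x - F y|)
    (hderiv : ∀ x ∈ Set.Icc (0 : Fin N → ℝ) 1, HasDerivWithinAt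
      (fun t => F (Function.update x n t)) (D x) (Set.Icc 0 1) (x n))
    (hDc : ContinuousOn D (Set.Icc 0 1))
    (hD : ∀ x ∈ Set.Icc (0 : Fin N → ℝ) 1, ∀ y ∈ Set.Icc (0 : Fin N → ℝ) 1,
      dist x y ≤ 1 / 2 ^ k → |D x - D y| ≤ η) :
    gridVariation k (fun c => φ (gridPoint k c)) n
      ≤ ∫ x, |D x| ∂(powMeasure lebUnit N) + 2 * η := by
  have hpos : (0 : ℝ) < 2 ^ k := by positivity
  have hη : 0 ≤ η := by
    have := hD 0 ⟨le_rfl, zero_le_one⟩ 0 ⟨le_rfl, zero_le_one⟩ (by simp)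
    simpa using this
  have hstep : ∀ (c : Fin N → Fin (2 ^ k)), ∀ j ∈ Finset.range (2 ^ k - 1),
      |φ (gridPoint k (Function.update (fun l => (c l : ℕ)) n (j + 1)))
        - φ (gridPoint k (Function.update (fun l => (c l : ℕ)) n j))|
      ≤ (|D (gridPoint k (Function.update (fun l => (c l : ℕ)) n j))| + η) / 2 ^ k := by
    intro c j hj
    have hj1 : j + 1 ≤ 2 ^ k := by have := Finset.mem_range.1 hj; omega
    have hj1' : ((j : ℝ) + 1) ≤ 2 ^ k := by exact_mod_cast hj1
    have hcm := gridPoint_mem k fun l => (c l).isLt.le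
    have hsub : Set.Icc (j / 2 ^ k : ℝ) ((j + 1) / 2 ^ k) ⊆ Set.Icc 0 1 :=
      Set.Icc_subset_Icc (by positivity) ((div_le_one hpos).2 hj1')
    have hle : (j / 2 ^ k : ℝ) ≤ (j + 1) / 2 ^ k := by gcongr; linarith
    refine (hφ _ _).trans ?_
    rw [gridPoint_update, gridPoint_update]
    push_cast
    set x := gridPoint k fun l => (c l : ℕ) with hx
    have hmv := Convex.norm_image_sub_le_of_norm_hasDerivWithin_le
      (s := Set.Icc (j / 2 ^ k : ℝ) ((j + 1) / 2 ^ k))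
      (f := fun t => F (Function.update x n t)) (f' := fun t => D (Function.update x n t))
      (C := |D (Function.update x n (j / 2 ^ k : ℝ))| + η) ?_ ?_ (convex_Icc _ _)
      (Set.left_mem_Icc.2 hle) (Set.right_mem_Icc.2 hle)
    · rw [Real.norm_eq_abs] at hmv
      refine hmv.trans (le_of_eq ?_)
      rw [Real.norm_eq_abs, ← sub_div, add_sub_cancel_left,
        abs_of_pos (show (0 : ℝ) < 1 / 2 ^ k by positivity)]
      ring
    · intro t ht
      have h1 := hderiv _ (update_mem_cube hcm n (hsub ht))
      simp only [Function.update_idem, Function.update_self] at h1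
      exact h1.mono hsub
    · intro t ht
      have h1 := hD _ (update_mem_cube hcm n (hsub ht)) _
        (update_mem_cube hcm n (hsub (Set.left_mem_Icc.2 hle))) (by
          refine (dist_pi_le_iff (by positivity)).2 fun l => ?_
          rcases eq_or_ne l n with rfl | hl
          · rw [Function.update_self, Function.update_self, Real.dist_eq,
              abs_of_nonneg (by linarith [ht.1])]
            have := ht.2
            rw [add_div] at this
            linarith
          · rw [Function.update_of_ne hl, Function.update_of_ne hl, dist_self]
            positivity)
      rw [Real.norm_eq_abs]
      have := abs_sub_abs_le_abs_sub (D (Function.update x n t))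
        (D (Function.update x n (j / 2 ^ k : ℝ)))
      linarith
  have hgrid : gridVariation k (fun c => φ (gridPoint k c)) n
      ≤ 𝔼 c : Fin N → Fin (2 ^ k), (|D (gridPoint k fun l => (c l : ℕ))| + η) := by
    rw [← expect_expect_update n, gridVariation]
    refine Finset.expect_le_expect fun c _ => (Finset.sum_le_sum (hstep c)).trans ?_
    rw [← Finset.sum_div, Fintype.expect_eq_sum_div_card, Fintype.card_fin, Nat.cast_pow,
      Nat.cast_ofNat]
    refine div_le_div_of_nonneg_right ?_ hpos.le
    simp only [update_val_comp]
    rw [Fin.sum_univ_eq_sum_range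
      (fun j => |D (gridPoint k (Function.update (fun l => (c l : ℕ)) n j))| + η) (2 ^ k)]
    refine Finset.sum_le_sum_of_subset_of_nonneg ?_ fun _ _ _ => by positivity
    exact Finset.range_subset_range.2 (Nat.sub_le _ _)
  refine hgrid.trans ?_
  rw [← integral_comp_gridCell k fun c => |D (gridPoint k fun l => (c l : ℕ))| + η]
  have hint := (integrable_of_continuousOn_cube hDc).abs
  calc _ ≤ ∫ x, (|D x| + 2 * η) ∂(powMeasure lebUnit N) := by
        refine integral_mono_of_nonneg (.of_forall fun x => by positivity)
          (hint.add (integrable_const _)) ?_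
        filter_upwards [ae_mem_cube N] with x hx
        have h1 := hD _ (gridPoint_mem k fun l => (gridCell k x l).isLt.le) x hx
          (by rw [dist_comm]; exact dist_gridPoint_gridCell_le k hx)
        have := abs_sub_abs_le_abs_sub (D (gridPoint k fun l => (gridCell k x l : ℕ))) (D x)
        linarith
    _ = _ := by rw [integral_add hint (integrable_const _)]; simp

/-- Truncation of a real number to `[-M, M]`. -/
def truncate (M y : ℝ) : ℝ := max (-M) (min M y)

lemma abs_truncate_le {M : ℝ} (hM : 0 ≤ M) (y : ℝ) : |truncate M y| ≤ M :=
  abs_le.2 ⟨le_max_left _ _, max_le (by linarith) (min_le_left _ _)⟩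

lemma abs_truncate_sub_truncate_le (M y z : ℝ) : |truncate M y - truncate M z| ≤ |y - z| :=
  (abs_max_sub_max_le_max _ _ _ _).trans (by
    simpa using abs_min_sub_min_le_max M y M z)

lemma abs_sub_truncate_le {M : ℝ} (hM : 0 < M) (y : ℝ) : |y - truncate M y| ≤ y ^ 2 / M := by
  rw [le_div_iff₀ hM, truncate]
  rcases le_total M y with h | h
  · rw [min_eq_left h, max_eq_right (by linarith), abs_of_nonneg (by linarith)]
    nlinarith
  · rw [min_eq_right h]
    rcases le_total (-M) y with h' | h'
    · rw [max_eq_right h']; simpa using sq_nonneg y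
    · rw [max_eq_left h', abs_of_nonpos (by linarith)]
      nlinarith

lemma continuous_truncate (M : ℝ) : Continuous (truncate M) := by
  unfold truncate; fun_prop

/-- Uniform continuity of a function on the cube, at the scale of all fine dyadic grids. -/
lemma eventually_abs_sub_le_of_dist_le {F : (Fin N → ℝ) → ℝ} (hF : ContinuousOn F (Set.Icc 0 1))
    {η : ℝ} (hη : 0 < η) : ∀ᶠ k : ℕ in Filter.atTop, ∀ x ∈ Set.Icc (0 : Fin N → ℝ) 1,
      ∀ y ∈ Set.Icc (0 : Fin N → ℝ) 1, dist x y ≤ 1 / 2 ^ k → |F x - F y| ≤ η := by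
  obtain ⟨ρ, hρ, h⟩ := Metric.uniformContinuousOn_iff.1
    (isCompact_Icc.uniformContinuousOn_of_continuous hF) η hη
  have h1 : Filter.Tendsto (fun k : ℕ => (1 : ℝ) / 2 ^ k) Filter.atTop (nhds 0) := by
    simpa using tendsto_pow_atTop_nhds_zero_of_lt_one (r := (1 / 2 : ℝ)) (by norm_num)
      (by norm_num)
  filter_upwards [h1.eventually_lt_const hρ] with k hk x hx y hy hxy
  exact (h x hx y hy (hxy.trans_lt hk)).le

end CubeCells

/-! ### Junta approximation on the cube -/

section CubeJunta

/-- Approximation by bounded juntas on the cube. The `L²` bound enters only through the truncation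
of `F - ∫ F` at a height `M ≈ 1 / ε`, and the mesh of the grid depends on `F` whereas the size of
the junta does not. -/
theorem exists_junta_cube {ε : ℝ} (hε : 0 < ε) : ∃ q : ℕ, 1 ≤ q ∧
    ∀ (N : ℕ) (F : (Fin N → ℝ) → ℝ) (D : Fin N → (Fin N → ℝ) → ℝ),
      ContinuousOn F (Set.Icc 0 1) → (∀ n, ContinuousOn (D n) (Set.Icc 0 1)) →
      (∀ x ∈ Set.Icc (0 : Fin N → ℝ) 1, ∀ n, HasDerivWithinAt
        (fun t => F (Function.update x n t)) (D n x) (Set.Icc 0 1) (x n)) →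
      ∑ n, ∫ x, |D n x| ∂(powMeasure lebUnit N) ≤ 1 →
      ∫ x, (F x - ∫ y, F y ∂(powMeasure lebUnit N)) ^ 2 ∂(powMeasure lebUnit N) ≤ 1 →
      ∃ (S : Finset (Fin N)) (g : (Fin N → ℝ) → ℝ), S.card ≤ q ∧ Measurable g ∧
        (∃ C, ∀ x, |g x| ≤ C) ∧ (∀ x y, (∀ n ∈ S, x n = y n) → g x = g y) ∧
        ∫ x, |F x - g x| ∂(powMeasure lebUnit N) < ε := by
  -- The error splits as `ε / 4` each for truncation, discretization and the junta on the grid; the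
  -- last one needs a squared error of `ε ^ 2 / 16`, shared by high and low degrees. The total
  -- variation on the grid is at most `K = 2`.
  set M : ℝ := 4 / ε with hM
  have hM0 : 0 < M := by positivity
  obtain ⟨d, hd⟩ := exists_nat_gt (M * (2 * 2) / (ε ^ 2 / 32))
  have hd0 : (0 : ℝ) < d := lt_trans (by positivity) hd
  have hd' : M * (2 * 2) / d ≤ ε ^ 2 / 32 := by
    rw [div_lt_iff₀ (by positivity)] at hd
    rw [div_le_iff₀ hd0]
    linarith
  set ρ : ℝ := ε ^ 2 / (128 * 3 ^ d) with hρ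
  have hρ0 : 0 < ρ := by positivity
  set δ : ℝ := ρ ^ 2 / M with hδ
  have hδ0 : 0 < δ := by positivity
  have hδ' : 3 ^ d * (2 * 2) * √(M * δ) = ε ^ 2 / 32 := by
    have : M * δ = ρ ^ 2 := by rw [hδ]; field_simp
    rw [this, Real.sqrt_sq hρ0.le, hρ]
    field_simp
    norm_num
  obtain ⟨q, hq⟩ := exists_nat_gt (2 * 2 / δ)
  refine ⟨q + 1, by omega, fun N F D hF hDc hderiv hgrad hvar => ?_⟩
  set μ := powMeasure lebUnit N with hμ
  set a := ∫ y, F y ∂μ with ha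
  set φ : (Fin N → ℝ) → ℝ := fun x => truncate M (F x - a) with hφ
  have hφM : ∀ x, |φ x| ≤ M := fun x => abs_truncate_le hM0.le _
  have hφF : ∀ x y, |φ x - φ y| ≤ |F x - F y| := fun x y =>
    (abs_truncate_sub_truncate_le _ _ _).trans (by simp)
  have hφc : ContinuousOn φ (Set.Icc 0 1) :=
    (continuous_truncate M).comp_continuousOn (hF.sub continuousOn_const)
  -- Each of the `N` directions loses `2 * η` in the comparison with `‖∂_n F‖_1`, less than `1` in
  -- total.
  set η : ℝ := 1 / (2 * (N + 1)) with hη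
  have hη0 : 0 < η := by positivity
  obtain ⟨k, hkφ, hkD⟩ := ((eventually_abs_sub_le_of_dist_le hφc
    (show (0 : ℝ) < ε / 4 by positivity)).and (Filter.eventually_all.2 fun n =>
      eventually_abs_sub_le_of_dist_le (hDc n) hη0)).exists
  set G : (Fin N → ℕ) → ℝ := fun c => φ (gridPoint k c) with hG
  have hvarG : ∑ n, gridVariation k G n ≤ 2 := by
    calc _ ≤ ∑ n, (∫ x, |D n x| ∂μ + 2 * η) := Finset.sum_le_sum fun n _ =>
          gridVariation_le n k hφF (fun x hx => hderiv x hx n) (hDc n) (hkD n)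
      _ = (∑ n, ∫ x, |D n x| ∂μ) + N * (2 * η) := by
          rw [Finset.sum_add_distrib]; simp
      _ ≤ 1 + 1 := by
          gcongr
          rw [hη]
          field_simp
          linarith
      _ = 2 := by norm_num
  obtain ⟨S, g, hS, hgS, hg⟩ := exists_junta_grid k G (fun c => hφM _) hvarG hδ0.le d
    (by exact_mod_cast hd0)
  have hg' : ∫ x, |G (fun l => (gridCell k x l : ℕ)) - g (gridCell k x)| ∂μ ≤ ε / 4 := by
    rw [hμ, integral_comp_gridCell k fun c => |G (fun l => (c l : ℕ)) - g c|]
    refine (abs_le_of_sq_le_sq' ?_ (by positivity)).2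
    refine hg.trans ?_
    rw [hδ']
    refine (add_le_add_left hd' _).trans (le_of_eq ?_)
    ring
  have hgm : Measurable fun x : Fin N → ℝ => g (gridCell k x) :=
    (Measurable.of_discrete (f := g)).comp (measurable_gridCell k)
  obtain ⟨C, hC⟩ : ∃ C, ∀ c, |g c| ≤ C :=
    ⟨∑ c, |g c|, fun c => Finset.single_le_sum (f := fun c => |g c|)
      (fun _ _ => abs_nonneg _) (Finset.mem_univ c)⟩
  refine ⟨S, fun x => a + g (gridCell k x), ?_, hgm.const_add a, ⟨|a| + C, fun x => ?_⟩, ?_, ?_⟩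
  · have h1 : (S.card : ℝ) ≤ 2 * 2 / δ := by
      rw [le_div_iff₀ hδ0, mul_comm]; exact hS
    have h2 : (S.card : ℝ) ≤ (q + 1 : ℕ) := by push_cast; linarith
    exact_mod_cast h2
  · exact (abs_add_le _ _).trans (by linarith [hC (gridCell k x)])
  · intro x y hxy
    simp only
    rw [hgS (gridCell k x) (gridCell k y) fun n hn => by simp only [gridCell, hxy n hn]]
  · have hFa : ContinuousOn (fun x => F x - a) (Set.Icc 0 1) := hF.sub continuousOn_const
    have hi2 : Integrable (fun x => (F x - a) ^ 2 / M) μ :=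
      integrable_of_continuousOn_cube ((hFa.pow 2).div_const M)
    have hi2' : Integrable (fun x => (F x - a) ^ 2 / M + ε / 4) μ := hi2.add (integrable_const _)
    have hGm : Measurable fun x : Fin N → ℝ =>
        |G (fun l => (gridCell k x l : ℕ)) - g (gridCell k x)| :=
      (Measurable.of_discrete (f := fun c : Fin N → Fin (2 ^ k) =>
        |G (fun l => (c l : ℕ)) - g c|)).comp (measurable_gridCell k)
    have hi3 : Integrable (fun x => |G (fun l => (gridCell k x l : ℕ)) - g (gridCell k x)|) μ := by
      refine Integrable.of_bound hGm.aestronglyMeasurable (M + C) (.of_forall fun x => ?_)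
      rw [Real.norm_eq_abs, abs_abs]
      exact (abs_sub _ _).trans (add_le_add (hφM _) (hC _))
    calc _ ≤ ∫ x, ((F x - a) ^ 2 / M + ε / 4
            + |G (fun l => (gridCell k x l : ℕ)) - g (gridCell k x)|) ∂μ := by
          refine integral_mono_of_nonneg (.of_forall fun x => abs_nonneg _)
            (hi2'.add hi3) ?_
          filter_upwards [ae_mem_cube N] with x hx
          have h1 := abs_sub_truncate_le hM0 (F x - a)
          have h2 := hkφ x hx _ (gridPoint_mem k fun l => (gridCell k x l).isLt.le)
            (dist_gridPoint_gridCell_le k hx)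
          have h3 : F x - (a + g (gridCell k x)) = (F x - a - φ x)
              + (φ x - G fun l => (gridCell k x l : ℕ))
              + (G (fun l => (gridCell k x l : ℕ)) - g (gridCell k x)) := by ring
          rw [h3]
          exact (abs_add_three _ _ _).trans (add_le_add (add_le_add h1 h2) le_rfl)
      _ = (∫ x, (F x - a) ^ 2 ∂μ) / M + ε / 4
            + ∫ x, |G (fun l => (gridCell k x l : ℕ)) - g (gridCell k x)| ∂μ := by
          rw [integral_add hi2' hi3, integral_add hi2 (integrable_const _), integral_div]
          simp
      _ ≤ 1 / M + ε / 4 + ε / 4 := by gcongr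
      _ < ε := by
          rw [hM, one_div_div]
          linarith

end CubeJunta

/-! ### The operators `E_S` -/

section CondE

variable {X : Type*} [MeasurableSpace X] {μ : Measure X} [IsProbabilityMeasure μ] {N : ℕ}

/-- Bounded measurable functions: a class stable under the operators `integrateOut`, on which every
integral involved converges. -/
def IsBoundedMeasurable {Ω : Type*} [MeasurableSpace Ω] (f : Ω → ℝ) : Prop :=
  Measurable f ∧ ∃ C, ∀ x, |f x| ≤ C

lemma IsBoundedMeasurable.integrable {Ω : Type*} [MeasurableSpace Ω] {ν : Measure Ω}
    [IsFiniteMeasure ν] {f : Ω → ℝ} (hf : IsBoundedMeasurable f) : Integrable f ν :=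
  let ⟨C, hC⟩ := hf.2
  Integrable.of_bound hf.1.aestronglyMeasurable C (.of_forall hC)

lemma IsBoundedMeasurable.comp {Ω Ω' : Type*} [MeasurableSpace Ω] [MeasurableSpace Ω']
    {f : Ω → ℝ} (hf : IsBoundedMeasurable f) {u : Ω' → Ω} (hu : Measurable u) :
    IsBoundedMeasurable fun x => f (u x) :=
  ⟨hf.1.comp hu, hf.2.imp fun _ hC x => hC (u x)⟩

lemma IsBoundedMeasurable.sub {Ω : Type*} [MeasurableSpace Ω] {f g : Ω → ℝ}
    (hf : IsBoundedMeasurable f) (hg : IsBoundedMeasurable g) :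
    IsBoundedMeasurable fun x => f x - g x := by
  obtain ⟨C, hC⟩ := hf.2
  obtain ⟨C', hC'⟩ := hg.2
  exact ⟨hf.1.sub hg.1, C + C', fun x => (abs_sub _ _).trans (add_le_add (hC x) (hC' x))⟩

/-- Resampling one coordinate preserves the product measure. -/
lemma measurePreserving_update (μ : Measure X) [IsProbabilityMeasure μ] (n : Fin N) :
    MeasurePreserving (fun p : (Fin N → X) × X => Function.update p.1 n p.2)
      ((powMeasure μ N).prod μ) (powMeasure μ N) := by
  have hm : Measurable fun p : (Fin N → X) × X => Function.update p.1 n p.2 := measurable_update'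
  refine ⟨hm, (Measure.pi_eq fun s hs => ?_).symm⟩
  rw [Measure.map_apply hm (.univ_pi hs)]
  have h1 : (fun p : (Fin N → X) × X => Function.update p.1 n p.2) ⁻¹' Set.univ.pi s
      = (Set.univ.pi (Function.update s n Set.univ)) ×ˢ s n := by
    ext p
    simp only [Set.mem_preimage, Set.mem_pi, Set.mem_univ, true_imp_iff, Set.mem_prod]
    constructor
    · intro h
      refine ⟨fun i => ?_, by simpa using h n⟩
      rcases eq_or_ne i n with rfl | hi
      · simp
      · simpa [hi] using h i
    · rintro ⟨h, hn⟩ i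
      rcases eq_or_ne i n with rfl | hi
      · simpa using hn
      · simpa [hi] using h i
  rw [h1, Measure.prod_prod, powMeasure, Measure.pi_pi,
    ← Finset.mul_prod_erase _ _ (Finset.mem_univ n),
    ← Finset.mul_prod_erase _ (fun i => μ (s i)) (Finset.mem_univ n)]
  rw [Function.update_self, measure_univ, one_mul, mul_comm]
  congr 1
  refine Finset.prod_congr rfl fun i hi => ?_
  rw [Function.update_of_ne (Finset.ne_of_mem_erase hi)]

lemma IsBoundedMeasurable.integrateOut {f : (Fin N → X) → ℝ} (hf : IsBoundedMeasurable f)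
    (n : Fin N) : IsBoundedMeasurable (integrateOut μ n f) := by
  have h1 := (hf.comp (measurePreserving_update μ n).measurable).1
  refine ⟨h1.stronglyMeasurable.integral_prod_right'.measurable, ?_⟩
  obtain ⟨C, hC⟩ := hf.2
  refine ⟨C, fun x => ?_⟩
  have := norm_integral_le_of_norm_le_const (μ := μ) (f := fun y => f (Function.update x n y))
    (.of_forall fun y => hC _)
  simpa [Junta.integrateOut] using this

lemma integral_abs_integrateOut_le {f : (Fin N → X) → ℝ} (hf : IsBoundedMeasurable f)
    (n : Fin N) :
    ∫ x, |integrateOut μ n f x| ∂(powMeasure μ N) ≤ ∫ x, |f x| ∂(powMeasure μ N) := by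
  have hmp := measurePreserving_update μ n
  have hint : Integrable (fun p : (Fin N → X) × X => |f (Function.update p.1 n p.2)|)
    ((powMeasure μ N).prod μ) := (hf.comp hmp.measurable).integrable.abs
  calc _ ≤ ∫ x, ∫ y, |f (Function.update x n y)| ∂μ ∂(powMeasure μ N) :=
        integral_mono_of_nonneg (.of_forall fun x => abs_nonneg _) hint.integral_prod_left
          (.of_forall fun x => abs_integral_le_integral_abs)
    _ = ∫ x, |f x| ∂(powMeasure μ N) := by
        rw [← integral_prod _ hint, ← hmp.map_eq,
          integral_map hmp.measurable.aemeasurable (by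
            rw [hmp.map_eq]; exact hf.integrable.abs.aestronglyMeasurable), hmp.map_eq]

lemma IsBoundedMeasurable.foldr_integrateOut {f : (Fin N → X) → ℝ} (hf : IsBoundedMeasurable f)
    (l : List (Fin N)) :
    IsBoundedMeasurable (l.foldr (fun n F => Junta.integrateOut μ n F) f) := by
  induction l with
  | nil => exact hf
  | cons n l ih => exact ih.integrateOut n

lemma IsBoundedMeasurable.condE {f : (Fin N → X) → ℝ} (hf : IsBoundedMeasurable f)
    (S : Finset (Fin N)) : IsBoundedMeasurable (condE μ S f) :=
  hf.foldr_integrateOut (μ := μ) _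

/-- Integrating out coordinates does not increase the `L¹` distance to a function that does not
depend on them. -/
lemma integral_abs_foldr_integrateOut_sub_le {f g : (Fin N → X) → ℝ}
    (hf : IsBoundedMeasurable f) (hg : IsBoundedMeasurable g) (l : List (Fin N))
    (hgl : ∀ n ∈ l, ∀ x t, g (Function.update x n t) = g x) :
    ∫ x, |l.foldr (fun n F => integrateOut μ n F) f x - g x| ∂(powMeasure μ N)
      ≤ ∫ x, |f x - g x| ∂(powMeasure μ N) := by
  induction l with
  | nil => exact le_rfl
  | cons n l ih =>
    have hle := ih fun m hm => hgl m (List.mem_cons_of_mem _ hm)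
    have hb : IsBoundedMeasurable (l.foldr (fun n F => integrateOut μ n F) f) :=
      hf.foldr_integrateOut l
    refine le_trans (le_of_eq ?_) ((integral_abs_integrateOut_le (hb.sub hg) n).trans hle)
    refine integral_congr_ae (.of_forall fun x => ?_)
    have hu : Measurable fun y => Function.update x n y := measurable_update x
    have h1 : ∫ y, g (Function.update x n y) ∂μ = g x := by
      simp [hgl n List.mem_cons_self]
    simp only [List.foldr_cons, integrateOut]
    rw [integral_sub (hb.comp hu).integrable (hg.comp hu).integrable, h1]

/-- `E_S f` is, up to a factor `2`, a best `L¹` approximation of `f` by functions of the coordinates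
in `S`. -/
lemma integral_abs_sub_condE_le {f g : (Fin N → X) → ℝ} (hf : IsBoundedMeasurable f)
    (hg : IsBoundedMeasurable g) (S : Finset (Fin N))
    (hgS : ∀ x y, (∀ n ∈ S, x n = y n) → g x = g y) :
    ∫ x, |f x - condE μ S f x| ∂(powMeasure μ N) ≤ 2 * ∫ x, |f x - g x| ∂(powMeasure μ N) := by
  have hle : ∫ x, |condE μ S f x - g x| ∂(powMeasure μ N)
      ≤ ∫ x, |f x - g x| ∂(powMeasure μ N) :=
    integral_abs_foldr_integrateOut_sub_le hf hg _ fun n hn x t => hgS _ _ fun m hm => by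
      rw [Finset.mem_sort, Finset.mem_compl] at hn
      rw [Function.update_of_ne (by rintro rfl; exact hn hm)]
  have h1 := (hf.sub hg).integrable (ν := powMeasure μ N).abs
  have h2 := ((hf.condE (μ := μ) S).sub hg).integrable (ν := powMeasure μ N).abs
  calc _ ≤ ∫ x, (|f x - g x| + |condE μ S f x - g x|) ∂(powMeasure μ N) := by
        refine integral_mono_of_nonneg (.of_forall fun x => abs_nonneg _) (h1.add h2)
          (.of_forall fun x => ?_)
        simp only
        rw [abs_sub_comm (condE μ S f x)]
        exact abs_sub_le _ _ _
    _ = ∫ x, |f x - g x| ∂(powMeasure μ N) + ∫ x, |condE μ S f x - g x| ∂(powMeasure μ N) :=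
        integral_add h1 h2
    _ ≤ _ := by
        rw [two_mul]
        exact add_le_add le_rfl hle

end CondE

/-! ### From juntas to `E_S` on the cube -/

section Cube

variable {N : ℕ}

/-- The nearest-point retraction of `ℝ^N` onto the unit cube. -/
def clampCube (x : Fin N → ℝ) : Fin N → ℝ := fun n => max 0 (min 1 (x n))

lemma clampCube_mem (x : Fin N → ℝ) : clampCube x ∈ Set.Icc (0 : Fin N → ℝ) 1 :=
  ⟨fun _ => le_max_left _ _, fun _ => max_le zero_le_one (min_le_left _ _)⟩

lemma clampCube_of_mem {x : Fin N → ℝ} (hx : x ∈ Set.Icc (0 : Fin N → ℝ) 1) :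
    clampCube x = x := by
  ext n
  have h0 : 0 ≤ x n := hx.1 n
  have h1 : x n ≤ 1 := hx.2 n
  rw [clampCube, min_eq_right h1, max_eq_right h0]

lemma isBoundedMeasurable_comp_clampCube {f : (Fin N → ℝ) → ℝ}
    (hf : ContinuousOn f (Set.Icc 0 1)) : IsBoundedMeasurable fun x => f (clampCube x) := by
  have hc : Continuous (clampCube : (Fin N → ℝ) → Fin N → ℝ) := by
    unfold clampCube; fun_prop
  refine ⟨(hf.comp_continuous hc clampCube_mem).measurable, ?_⟩
  obtain ⟨C, hC⟩ := isCompact_Icc.exists_bound_of_continuousOn hf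
  exact ⟨C, fun x => hC _ (clampCube_mem x)⟩

lemma condE_lebUnit_congr {f f' : (Fin N → ℝ) → ℝ} (h : Set.EqOn f f' (Set.Icc 0 1))
    (S : Finset (Fin N)) : Set.EqOn (condE lebUnit S f) (condE lebUnit S f') (Set.Icc 0 1) := by
  unfold condE
  induction Sᶜ.sort (· ≤ ·) with
  | nil => exact h
  | cons n l ih =>
    intro x hx
    exact setIntegral_congr_fun measurableSet_Icc fun t ht => ih (update_mem_cube hx n ht)

/-- The `n`-th partial derivative of a `C¹` function on the cube, as a function that is visibly
continuous up to the boundary. -/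
noncomputable def cubePartial (f : (Fin N → ℝ) → ℝ) (n : Fin N) (x : Fin N → ℝ) : ℝ :=
  fderivWithin ℝ f (Set.Icc 0 1) x (Pi.single n 1)

lemma continuousOn_cubePartial {f : (Fin N → ℝ) → ℝ} (hf : IsC1Cube f) (n : Fin N) :
    ContinuousOn (cubePartial f n) (Set.Icc 0 1) := by
  have hu : UniqueDiffOn ℝ (Set.Icc (0 : Fin N → ℝ) 1) := by
    rw [← Set.pi_univ_Icc]
    exact UniqueDiffOn.univ_pi fun _ => uniqueDiffOn_Icc_zero_one
  exact (ContDiffOn.continuousOn_fderivWithin hf hu le_rfl).clm_apply continuousOn_const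

lemma hasDerivWithinAt_cubePartial {f : (Fin N → ℝ) → ℝ} (hf : IsC1Cube f) {x : Fin N → ℝ}
    (hx : x ∈ Set.Icc (0 : Fin N → ℝ) 1) (n : Fin N) :
    HasDerivWithinAt (fun t => f (Function.update x n t)) (cubePartial f n x)
      (Set.Icc 0 1) (x n) := by
  have h1 := (ContDiffOn.differentiableOn hf one_ne_zero x hx).hasFDerivWithinAt
  have h2 := (hasDerivAt_update x n (x n)).hasDerivWithinAt (s := Set.Icc (0 : ℝ) 1)
  rw [← Function.update_eq_self n x] at h1
  have h3 := h1.comp_hasDerivWithinAt (x n) h2 fun t ht => update_mem_cube hx n ht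
  rwa [Function.update_eq_self] at h3

lemma gradCube_eq_cubePartial {f : (Fin N → ℝ) → ℝ} (hf : IsC1Cube f) {x : Fin N → ℝ}
    (hx : x ∈ Set.Icc (0 : Fin N → ℝ) 1) (n : Fin N) : gradCube f x n = cubePartial f n x :=
  (hasDerivWithinAt_cubePartial hf hx n).derivWithin
    (uniqueDiffOn_Icc_zero_one _ ⟨hx.1 n, hx.2 n⟩)

lemma mixedNorm_one {Ω : Type*} [MeasurableSpace Ω] (ν : Measure Ω) (F : Ω → Fin N → ℝ) :
    mixedNorm 1 ν F = ∫⁻ x, ENNReal.ofReal (∑ n, |F x n|) ∂ν := by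
  rw [mixedNorm, eLpNorm_one_eq_lintegral_enorm]
  refine lintegral_congr fun x => ?_
  rw [← ofReal_norm, PiLp.norm_eq_of_L1]
  rfl

lemma sum_integral_abs_cubePartial_le {f : (Fin N → ℝ) → ℝ} (hf : IsC1Cube f)
    (h : mixedNorm 1 (powMeasure lebUnit N) (gradCube f) ≤ 1) :
    ∑ n, ∫ x, |cubePartial f n x| ∂(powMeasure lebUnit N) ≤ 1 := by
  have hi : ∀ n, Integrable (fun x => |cubePartial f n x|) (powMeasure lebUnit N) := fun n =>
    (integrable_of_continuousOn_cube (continuousOn_cubePartial hf n)).abs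
  rw [← integral_finsetSum _ fun n _ => hi n, ← ENNReal.ofReal_le_ofReal_iff zero_le_one,
    ofReal_integral_eq_lintegral_ofReal (integrable_finsetSum _ fun n _ => hi n)
      (.of_forall fun x => Finset.sum_nonneg fun n _ => abs_nonneg _), ENNReal.ofReal_one]
  refine le_trans (le_of_eq ?_) h
  rw [mixedNorm_one]
  refine lintegral_congr_ae ?_
  filter_upwards [ae_mem_cube N] with x hx
  simp only [gradCube_eq_cubePartial hf hx]

lemma integral_sq_le_one_of_eLpNorm_two_le {Ω : Type*} [MeasurableSpace Ω] {ν : Measure Ω}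
    {F : Ω → ℝ} (hF : Integrable (fun x => F x ^ 2) ν) (h : eLpNorm F 2 ν ≤ 1) :
    ∫ x, F x ^ 2 ∂ν ≤ 1 := by
  rw [← ENNReal.ofReal_le_ofReal_iff zero_le_one, ENNReal.ofReal_one,
    ofReal_integral_eq_lintegral_ofReal hF (.of_forall fun x => sq_nonneg _)]
  have h1 : ∀ x, ENNReal.ofReal (F x ^ 2) = ‖F x‖ₑ ^ (2 : ℝ) := fun x => by
    rw [← ofReal_norm, ENNReal.rpow_two, ← ENNReal.ofReal_pow (norm_nonneg _),
      Real.norm_eq_abs, sq_abs]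
  simp only [h1]
  rw [eLpNorm_eq_lintegral_rpow_enorm_toReal two_ne_zero ENNReal.ofNat_ne_top,
    ENNReal.toReal_ofNat] at h
  exact not_lt.1 fun hlt => h.not_gt (ENNReal.one_lt_rpow hlt (by norm_num))

theorem exists_condE_cube {ε : ℝ} (hε : 0 < ε) : ∃ q : ℕ, 1 ≤ q ∧
    ∀ (N : ℕ) (f : (Fin N → ℝ) → ℝ), IsC1Cube f →
      mixedNorm 1 (powMeasure lebUnit N) (gradCube f) ≤ 1 →
      eLpNorm (fun x => f x - ∫ y, f y ∂(powMeasure lebUnit N)) 2 (powMeasure lebUnit N) ≤ 1 →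
      ∃ S : Finset (Fin N), S.card ≤ q ∧
        eLpNorm (fun x => f x - condE lebUnit S f x) 1 (powMeasure lebUnit N)
          < ENNReal.ofReal ε := by
  obtain ⟨q, hq, H⟩ := exists_junta_cube (half_pos hε)
  refine ⟨q, hq, fun N f hf hgrad hvar => ?_⟩
  have hfc : ContinuousOn f (Set.Icc 0 1) := ContDiffOn.continuousOn hf
  obtain ⟨S, g, hS, hgm, hgb, hgS, hfg⟩ := H N f (cubePartial f) hfc (continuousOn_cubePartial hf)
    (fun x hx n => hasDerivWithinAt_cubePartial hf hx n) (sum_integral_abs_cubePartial_le hf hgrad)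
    (integral_sq_le_one_of_eLpNorm_two_le
      (integrable_of_continuousOn_cube ((hfc.sub continuousOn_const).pow 2)) hvar)
  refine ⟨S, hS, ?_⟩
  set F : (Fin N → ℝ) → ℝ := fun x => f (clampCube x) with hF
  have hFb : IsBoundedMeasurable F := isBoundedMeasurable_comp_clampCube hfc
  have hfF : Set.EqOn f F (Set.Icc 0 1) := fun x hx => by simp only [hF, clampCube_of_mem hx]
  have hE := integral_abs_sub_condE_le (μ := lebUnit) hFb ⟨hgm, hgb⟩ S hgS
  have h1 : ∫ x, |F x - g x| ∂(powMeasure lebUnit N)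
      = ∫ x, |f x - g x| ∂(powMeasure lebUnit N) := by
    refine integral_congr_ae ?_
    filter_upwards [ae_mem_cube N] with x hx
    rw [hfF hx]
  have h2 : eLpNorm (fun x => f x - condE lebUnit S f x) 1 (powMeasure lebUnit N)
      = ENNReal.ofReal (∫ x, |F x - condE lebUnit S F x| ∂(powMeasure lebUnit N)) := by
    rw [eLpNorm_congr_ae (g := fun x => F x - condE lebUnit S F x),
      eLpNorm_one_eq_lintegral_enorm,
      ← ofReal_integral_norm_eq_lintegral_enorm (hFb.sub (hFb.condE S)).integrable]
    · rfl
    · filter_upwards [ae_mem_cube N] with x hx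
      rw [hfF hx, condE_lebUnit_congr hfF S hx]
  rw [h2, ENNReal.ofReal_lt_ofReal_iff hε]
  linarith

end Cube

/-! ### The torus -/

section Torus

variable {N : ℕ}

/-- The covering map `ℝ^N → 𝕋^N`. -/
def toTorus (x : Fin N → ℝ) : Fin N → UnitAddCircle := fun n => (x n : UnitAddCircle)

lemma isOpenQuotientMap_toTorus :
    IsOpenQuotientMap (toTorus : (Fin N → ℝ) → Fin N → UnitAddCircle) :=
  IsOpenQuotientMap.piMap fun _ => QuotientAddGroup.isOpenQuotientMap_mk

lemma measurePreserving_toTorus :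
    MeasurePreserving toTorus (powMeasure lebUnit N) (powMeasure haarCircle N) := by
  have h : MeasurePreserving (fun t : ℝ => (t : UnitAddCircle)) lebUnit haarCircle := by
    have h1 := UnitAddCircle.measurePreserving_mk 0
    rwa [zero_add, Measure.restrict_congr_set Ioc_ae_eq_Icc] at h1
  exact measurePreserving_pi _ _ fun _ => h

instance : IsProbabilityMeasure haarCircle := ⟨UnitAddCircle.measure_univ⟩

lemma toTorus_update (x : Fin N → ℝ) (n : Fin N) (t : ℝ) :
    toTorus (Function.update x n t) = Function.update (toTorus x) n (t : UnitAddCircle) := by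
  ext l
  rcases eq_or_ne l n with rfl | hl <;> simp [toTorus, *]

lemma continuous_of_comp_toTorus {f : (Fin N → UnitAddCircle) → ℝ}
    (hf : Continuous fun x => f (toTorus x)) : Continuous f :=
  isOpenQuotientMap_toTorus.isQuotientMap.continuous_iff.2 hf

lemma condE_comp_toTorus (f : (Fin N → UnitAddCircle) → ℝ) (S : Finset (Fin N))
    (x : Fin N → ℝ) :
    condE haarCircle S f (toTorus x) = condE lebUnit S (fun y => f (toTorus y)) x := by
  unfold condE
  induction Sᶜ.sort (· ≤ ·) generalizing x with
  | nil => rfl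
  | cons n l ih =>
    simp only [List.foldr_cons, integrateOut, ← ih, toTorus_update]
    rw [← UnitAddCircle.integral_preimage 0, zero_add, ← integral_Icc_eq_integral_Ioc]

lemma hasDerivAt_comp_update {F : (Fin N → ℝ) → ℝ} (hF : ContDiff ℝ 1 F) (x : Fin N → ℝ)
    (n : Fin N) :
    HasDerivAt (fun t => F (Function.update x n t)) (fderiv ℝ F x (Pi.single n 1)) (x n) := by
  have h1 := (hF.differentiable one_ne_zero x).hasFDerivAt
  rw [← Function.update_eq_self n x] at h1
  have h2 := h1.comp_hasDerivAt (x n) (hasDerivAt_update x n (x n))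
  rwa [Function.update_eq_self] at h2

lemma gradTorus_toTorus {f : (Fin N → UnitAddCircle) → ℝ} (hf : IsC1Torus f) (x : Fin N → ℝ)
    (n : Fin N) :
    gradTorus f (toTorus x) n = fderiv ℝ (fun y => f (toTorus y)) x (Pi.single n 1) := by
  have h1 : ∀ t : ℝ, f (toTorus (Function.update x n (x n + t)))
      = f (Function.update (toTorus x) n (toTorus x n + (t : UnitAddCircle))) := fun t => by
    rw [toTorus_update]
    rfl
  have h2 : HasDerivAt (fun t => f (toTorus (Function.update x n t)))
      (fderiv ℝ (fun y => f (toTorus y)) x (Pi.single n 1)) (x n + 0) := by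
    rw [add_zero]
    exact hasDerivAt_comp_update hf x n
  have h3 := h2.comp_const_add (x n) 0
  simp only [h1] at h3
  exact h3.deriv

lemma continuous_gradTorus {f : (Fin N → UnitAddCircle) → ℝ} (hf : IsC1Torus f) (n : Fin N) :
    Continuous fun x => gradTorus f x n := by
  refine continuous_of_comp_toTorus ?_
  simp only [gradTorus_toTorus hf]
  exact (ContDiff.continuous_fderiv hf one_ne_zero).clm_apply continuous_const

lemma mixedNorm_gradCube_comp_toTorus {f : (Fin N → UnitAddCircle) → ℝ} (hf : IsC1Torus f) :
    mixedNorm 1 (powMeasure lebUnit N) (gradCube fun x => f (toTorus x))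
      = mixedNorm 1 (powMeasure haarCircle N) (gradTorus f) := by
  have hm : Measurable fun x => ENNReal.ofReal (∑ n, |gradTorus f x n|) :=
    ENNReal.measurable_ofReal.comp
      (Finset.measurable_sum _ fun n _ => (continuous_gradTorus hf n).abs.measurable)
  rw [mixedNorm_one, mixedNorm_one, ← measurePreserving_toTorus.lintegral_comp hm]
  refine lintegral_congr_ae ?_
  filter_upwards [ae_mem_cube N] with x hx
  congr 1
  refine Finset.sum_congr rfl fun n _ => ?_
  have h1 : HasDerivAt (fun t => f (toTorus (Function.update x n t))) _ (x n) :=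
    hasDerivAt_comp_update hf x n
  rw [gradTorus_toTorus hf, gradCube, h1.hasDerivWithinAt.derivWithin
    (uniqueDiffOn_Icc_zero_one _ ⟨hx.1 n, hx.2 n⟩)]
  rfl

theorem exists_condE_torus {ε : ℝ} (hε : 0 < ε) : ∃ q : ℕ, 1 ≤ q ∧
    ∀ (N : ℕ) (f : (Fin N → UnitAddCircle) → ℝ), IsC1Torus f →
      mixedNorm 1 (powMeasure haarCircle N) (gradTorus f) ≤ 1 →
      eLpNorm (fun x => f x - ∫ y, f y ∂(powMeasure haarCircle N)) 2 (powMeasure haarCircle N)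
        ≤ 1 →
      ∃ S : Finset (Fin N), S.card ≤ q ∧
        eLpNorm (fun x => f x - condE haarCircle S f x) 1 (powMeasure haarCircle N)
          < ENNReal.ofReal ε := by
  obtain ⟨q, hq, H⟩ := exists_condE_cube hε
  refine ⟨q, hq, fun N f hf hgrad hvar => ?_⟩
  have hmp := measurePreserving_toTorus (N := N)
  have hc : Continuous f := continuous_of_comp_toTorus (ContDiff.continuous hf)
  have hb : IsBoundedMeasurable f := by
    refine ⟨hc.measurable, ?_⟩
    obtain ⟨C, hC⟩ := isCompact_univ.exists_bound_of_continuousOn hc.continuousOn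
    exact ⟨C, fun x => hC x (Set.mem_univ x)⟩
  have hmean : ∫ y, f (toTorus y) ∂(powMeasure lebUnit N)
      = ∫ y, f y ∂(powMeasure haarCircle N) := by
    rw [← hmp.map_eq, integral_map hmp.measurable.aemeasurable hc.aestronglyMeasurable]
  obtain ⟨S, hS, hE⟩ := H N (fun x => f (toTorus x)) (ContDiff.contDiffOn hf)
    ((mixedNorm_gradCube_comp_toTorus hf).trans_le hgrad) (by
      rw [hmean]
      exact (eLpNorm_comp_measurePreserving
        (g := fun x => f x - ∫ y, f y ∂(powMeasure haarCircle N))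
        (hc.sub continuous_const).aestronglyMeasurable hmp).trans_le hvar)
  refine ⟨S, hS, lt_of_eq_of_lt ?_ hE⟩
  rw [← eLpNorm_comp_measurePreserving (hb.sub (hb.condE S)).1.aestronglyMeasurable hmp]
  simp only [Function.comp_def, condE_comp_toTorus]

end Torus

end Junta

theorem theorem2p1 :
    (∀ ε : ℝ, 0 < ε → ∃ q : ℕ, 1 ≤ q ∧
      ∀ (N : ℕ) (f : (Fin N → UnitAddCircle) → ℝ),
        Junta.IsC1Torus f →
        Junta.mixedNorm 1 (Junta.powMeasure Junta.haarCircle N) (Junta.gradTorus f) ≤ 1 →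
        eLpNorm (fun x => f x - ∫ y, f y ∂(Junta.powMeasure Junta.haarCircle N)) 2
          (Junta.powMeasure Junta.haarCircle N) ≤ 1 →
        ∃ S : Finset (Fin N), S.card ≤ q ∧
          eLpNorm (fun x => f x - Junta.condE Junta.haarCircle S f x) 1
            (Junta.powMeasure Junta.haarCircle N) < ENNReal.ofReal ε) ∧
    (∀ ε : ℝ, 0 < ε → ∃ q : ℕ, 1 ≤ q ∧
      ∀ (N : ℕ) (f : (Fin N → ℝ) → ℝ),
        Junta.IsC1Cube f →
        Junta.mixedNorm 1 (Junta.powMeasure Junta.lebUnit N) (Junta.gradCube f) ≤ 1 →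
        eLpNorm (fun x => f x - ∫ y, f y ∂(Junta.powMeasure Junta.lebUnit N)) 2
          (Junta.powMeasure Junta.lebUnit N) ≤ 1 →
        ∃ S : Finset (Fin N), S.card ≤ q ∧
          eLpNorm (fun x => f x - Junta.condE Junta.lebUnit S f x) 1
            (Junta.powMeasure Junta.lebUnit N) < ENNReal.ofReal ε) :=
  ⟨fun _ hε => Junta.exists_condE_torus hε, fun _ hε => Junta.exists_condE_cube hε⟩
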